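/- Let $D\ge 4$ be an integer and let $a\in\mathbb R$. Indices $I,J,K,L$ run over $D-3$ values ($3,\dots,D-1$), and repeated indices are summed. Let $N$ be the set of all tuples $(f_{IJ},Q_I,\Phi_I,\Psi,\phi)$ of real numbers with $(f_{IJ})$ symmetric and positive definite; write $f=\det(f_{IJ})$ and $(f^{IJ})=(f_{IJ})^{-1}$. Then $N$ is open in the space of all such tuples with $(f_{IJ})$ symmetric, it is diffeomorphic to $\mathbb R^{\frac12(D-2)(D+1)}$, and $$h=\frac{df^2}{4f^2}+\frac14 f^{IJ}f^{KL}df_{IK}df_{JL}+e^{-2a\phi}f^{IJ}d\Phi_Id\Phi_J+\frac{e^{2a\phi}}{f}d\Psi^2+\frac1{2f}f^{IJ}(dQ_I+\Psi d\Phi_I-\Phi_Id\Psi)(dQ_J+\Psi d\Phi_J-\Phi_Jd\Psi)+2d\phi^2$$ is a smooth Riemannian metric on $N$. Let $M=(0,\infty)\times T^2$ with coordinates $(t,\theta,\psi)$, $\theta,\psi\in\mathbb R/2\pi\mathbb Z$, and with the Lorentzian metric $\eta=-dt^2+d\theta^2+t^2d\psi^2$. Let $U=(f_{IJ},Q_I,\Phi_I,\Psi,\phi):M\to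 N$ be smooth and independent of $\psi$, let $\lambda$ be any smooth function on $M$ independent of $\psi$, and let $\nabla$ and $\Box=\nabla^m\nabla_m$ be the covariant derivative and the d'Alembertian of $\gamma=e^{2\lambda}(-dt^2+d\theta^2)+t^2d\psi^2$. Put $A_{I\,m}=\nabla_mQ_I+\Psi\nabla_m\Phi_I-\Phi_I\nabla_m\Psi$. Then $U:(M,\eta)\to(N,h)$ is a wave map, i.e. a critical point, with respect to smooth variations compactly supported in $M$ (not necessarily independent of $\psi$), of $$S_{\rm WM}=\int dt\,d\theta\,d\psi\,\sqrt{-\det\eta}\;\eta^{\alpha\beta}h_{AB}(U)\,\partial_\alpha U^A\partial_\beta U^B,$$ if and only if the following evolution equations of the $T^{D-2}$-symmetric Einstein--Maxwell--dilaton system in areal time hold on $M$ for all $I,J$: $$\Box\phi=-\tfrac a2\big(e^{-2a\phi}f^{IJ}\nabla^m\Phi_I\nabla_m\Phi_J-e^{2a\phi}f^{-1}\nabla^m\Psi\nabla_m\Psi\big),$$ $$\begin{aligned}\Box Q_I={}&f^{-1}(\nabla^mf+e^{2a\phi}\Psi\nabla^m\Psi)A_{I\,m}+f^{JK}(\nabla^mf_{IJ}+e^{-2a\phi}\Phi_I\nabla^m\Phi_J)A_{K\,m}\\&+f^{-1}\Phi_I\nabla^mf\nabla_m\Psi-f^{JK}\Psi\nabla^mf_{IJ}\nabla_m\Phi_K-2a\nabla^m\phi\,(\Psi\nabla_m\Phi_I+\Phi_I\nabla_m\Psi),\end{aligned}$$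 $$\begin{aligned}\Box f_{IJ}={}&f^{KL}\nabla^mf_{IK}\nabla_mf_{JL}-f^{-1}A_I{}^mA_{J\,m}-2e^{-2a\phi}\nabla^m\Phi_I\nabla_m\Phi_J\\&+\tfrac2{D-2}f_{IJ}\big(e^{-2a\phi}f^{KL}\nabla^m\Phi_K\nabla_m\Phi_L-e^{2a\phi}f^{-1}\nabla^m\Psi\nabla_m\Psi\big),\end{aligned}$$ $$\Box\Phi_I=f^{JK}\nabla^mf_{IJ}\nabla_m\Phi_K-f^{-1}e^{2a\phi}\nabla^m\Psi A_{I\,m}+2a\nabla^m\phi\nabla_m\Phi_I,$$ $$\Box\Psi=f^{-1}\nabla^mf\nabla_m\Psi+e^{-2a\phi}f^{IJ}\nabla^m\Phi_IA_{J\,m}-2a\nabla^m\phi\nabla_m\Psi.$$ -/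

import Mathlib

open scoped ContDiff

noncomputable section

namespace EMD

/-! ### The domain manifold -/

/-- Coordinates `(t, θ, ψ) = (x 0, x 1, x 2)`. -/
abbrev Coord := Fin 3 → ℝ

/-- The half space `t > 0`. Functions on the manifold `M = (0, ∞) × T²` are the functions on this
set that are `2π`-periodic in `θ` and in `ψ`. -/
def dom : Set Coord := {x | 0 < x 0}

/-- A smooth map on `M = (0, ∞) × T²` with values in `E`. -/
structure IsSmoothOnM {E : Type*} [NormedAddCommGroup E] [NormedSpace ℝ E]
    (u : Coord → E) : Prop where
  smooth : ContDiffOn ℝ ∞ u dom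
  periodic_theta : ∀ x ∈ dom, u (x + Pi.single 1 (2 * Real.pi)) = u x
  periodic_psi : ∀ x ∈ dom, u (x + Pi.single 2 (2 * Real.pi)) = u x

/-- `u` depends on `(t, θ)` only. -/
def PsiIndependent {E : Type*} (u : Coord → E) : Prop :=
  ∀ x ∈ dom, ∀ y ∈ dom, x 0 = y 0 → x 1 = y 1 → u x = u y

/-- The partial derivative `∂_m u`. -/
def pd {E : Type*} [NormedAddCommGroup E] [NormedSpace ℝ E]
    (m : Fin 3) (u : Coord → E) (x : Coord) : E :=
  fderiv ℝ u x (Pi.single m 1)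

/-- A (pseudo-Riemannian) metric on `M`, given by its matrix of components. -/
abbrev MetricField := Coord → Matrix (Fin 3) (Fin 3) ℝ

/-- `√(- det g)`. -/
def volDensity (g : MetricField) (x : Coord) : ℝ := Real.sqrt (-(g x).det)

/-- The covector field `∇_m u`. -/
def grad (u : Coord → ℝ) (x : Coord) : Fin 3 → ℝ := fun m => pd m u x

/-- The contraction `g^{mn} v_m w_n` of two covectors at `x`. -/
def ip (g : MetricField) (x : Coord) (v w : Fin 3 → ℝ) : ℝ :=
  ∑ m, ∑ n, (g x)⁻¹ m n * v m * w n

/-- The d'Alembertian `□ u = (- det g)^{-1/2} ∂_m ((- det g)^{1/2} g^{mn} ∂_n u)` of `g`. -/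
def box (g : MetricField) (u : Coord → ℝ) (x : Coord) : ℝ :=
  (volDensity g x)⁻¹ *
    ∑ m, pd m (fun y => volDensity g y * ∑ n, (g y)⁻¹ m n * pd n u y) x

/-- `η = - dt² + dθ² + t² dψ²`. -/
def etaMetric : MetricField := fun x => Matrix.diagonal ![-1, 1, x 0 ^ 2]

/-- `γ = e^{2λ} (- dt² + dθ²) + t² dψ²`. -/
def gammaMetric (lam : Coord → ℝ) : MetricField := fun x =>
  Matrix.diagonal ![-Real.exp (2 * lam x), Real.exp (2 * lam x), x 0 ^ 2]

/-! ### Wave maps into an open subset of a vector space -/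

section WaveMap

variable {E : Type*} [NormedAddCommGroup E] [NormedSpace ℝ E]

/-- `h u v w` (the value at `u` of the form `h` on tangent vectors `v`, `w`) is a smooth Riemannian
metric on the open set `N`. -/
structure IsRiemannianMetricOn (h : E → E → E → ℝ) (N : Set E) : Prop where
  add_left : ∀ u ∈ N, ∀ v v' w, h u (v + v') w = h u v w + h u v' w
  smul_left : ∀ u ∈ N, ∀ (c : ℝ) (v w), h u (c • v) w = c * h u v w
  symm : ∀ u ∈ N, ∀ v w, h u v w = h u w v
  pos : ∀ u ∈ N, ∀ v, v ≠ 0 → 0 < h u v v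
  smooth : ∀ v w, ContDiffOn ℝ ∞ (fun u => h u v w) N

/-- The Lagrangian density `√(- det g) g^{αβ} h_{AB}(U) ∂_α U^A ∂_β U^B`. -/
def waveMapLagrangian (g : MetricField) (h : E → E → E → ℝ) (U : Coord → E) (x : Coord) : ℝ :=
  volDensity g x * ∑ α, ∑ β, (g x)⁻¹ α β * h (U x) (pd α U x) (pd β U x)

/-- The action of `U` over the compact part `[t₀, t₁] × T²` of `M`. -/
def waveMapAction (g : MetricField) (h : E → E → E → ℝ) (t₀ t₁ : ℝ) (U : Coord → E) : ℝ :=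
  ∫ x in Set.Icc (![t₀, 0, 0] : Coord) ![t₁, 2 * Real.pi, 2 * Real.pi],
    waveMapLagrangian g h U x

/-- `U : (M, g) → (N, h)` is a wave map: it is smooth and it is a critical point of the action for
all smooth variations with compact support in `M`. (A subset of `M = (0, ∞) × T²` has compact
closure iff it lies in some slab `[t₀, t₁] × T²` with `0 < t₀`.) -/
structure IsWaveMap (g : MetricField) (N : Set E) (h : E → E → E → ℝ) (U : Coord → E) : Prop where
  smooth : IsSmoothOnM U
  mapsTo : Set.MapsTo U dom N
  critical : ∀ t₀ t₁ : ℝ, 0 < t₀ → t₀ < t₁ → ∀ W : Coord → E, IsSmoothOnM W →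
    (∀ x ∈ dom, x 0 ∉ Set.Icc t₀ t₁ → W x = 0) →
    HasDerivAt (fun s : ℝ => waveMapAction g h t₀ t₁ (fun x => U x + s • W x)) 0 0

/-- The set `N` is diffeomorphic to `ℝ^k`. -/
def IsDiffeomorphicToEuclidean (N : Set E) (k : ℕ) : Prop :=
  ∃ (e : EuclideanSpace ℝ (Fin k) → E) (e' : E → EuclideanSpace ℝ (Fin k)),
    ContDiff ℝ ∞ e ∧ ContDiffOn ℝ ∞ e' N ∧
    (∀ y, e y ∈ N ∧ e' (e y) = y) ∧ ∀ u ∈ N, e (e' u) = u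

end WaveMap

/-! ### The target -/

/-- Coordinates `(f_{IJ}, Q_I, Φ_I, Ψ, φ)`, with `n` values of the index `I`; the first component
is indexed by unordered pairs, so that `f_{IJ} = f_{JI}`. -/
abbrev Target (n : ℕ) :=
  (Sym2 (Fin n) → ℝ) × (Fin n → ℝ) × (Fin n → ℝ) × ℝ × ℝ

section Target

variable {n : ℕ}

/-- The symmetric matrix `f_{IJ}`. -/
def fMat (u : Target n) : Matrix (Fin n) (Fin n) ℝ := Matrix.of fun I J => u.1 s(I, J)

/-- The components `Q_I`. -/
def tQ (u : Target n) : Fin n → ℝ := u.2.1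

/-- The components `Φ_I`. -/
def tPhi (u : Target n) : Fin n → ℝ := u.2.2.1

/-- The component `Ψ`. -/
def tPsi (u : Target n) : ℝ := u.2.2.2.1

/-- The component `φ`. -/
def tDil (u : Target n) : ℝ := u.2.2.2.2

/-- The determinant `f = det f_{IJ}`. -/
def fDet (u : Target n) : ℝ := (fMat u).det

/-- The open set `N` of all `(f_{IJ}, Q_I, Φ_I, Ψ, φ)` with `f_{IJ}` positive definite. -/
def targetSet (n : ℕ) : Set (Target n) := {u | (fMat u).PosDef}

/-- The one-form `dQ_I + Ψ dΦ_I - Φ_I dΨ` at `u`. -/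
def twistForm (u : Target n) (I : Fin n) (v : Target n) : ℝ :=
  tQ v I + tPsi u * tPhi v I - tPhi u I * tPsi v

/-- The metric
`h = df² / (4 f²) + (1/4) f^{IJ} f^{KL} df_{IK} df_{JL} + e^{-2aφ} f^{IJ} dΦ_I dΦ_J
  + (e^{2aφ} / f) dΨ²
  + (1 / (2f)) f^{IJ} (dQ_I + Ψ dΦ_I - Φ_I dΨ) (dQ_J + Ψ dΦ_J - Φ_J dΨ) + 2 dφ²`,
as a symmetric bilinear form. -/
def targetMetric (a : ℝ) (u v w : Target n) : ℝ :=
  1 / (4 * fDet u ^ 2) * (fderiv ℝ fDet u v * fderiv ℝ fDet u w)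
  + 1 / 4 * ∑ I, ∑ J, ∑ K, ∑ L,
      (fMat u)⁻¹ I J * (fMat u)⁻¹ K L * fMat v I K * fMat w J L
  + Real.exp (-2 * a * tDil u) * ∑ I, ∑ J, (fMat u)⁻¹ I J * tPhi v I * tPhi w J
  + Real.exp (2 * a * tDil u) / fDet u * (tPsi v * tPsi w)
  + 1 / (2 * fDet u) * ∑ I, ∑ J, (fMat u)⁻¹ I J * twistForm u I v * twistForm u J w
  + 2 * (tDil v * tDil w)

end Target

/-! ### The evolution equations -/

section Evolution

variable {n : ℕ}

/-- The covector `∇_m Q_I + Ψ ∇_m Φ_I - Φ_I ∇_m Ψ`. -/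
def twistCov (Q Φ : Fin n → Coord → ℝ) (Ψ : Coord → ℝ) (I : Fin n) (x : Coord) : Fin 3 → ℝ :=
  grad (Q I) x + Ψ x • grad (Φ I) x - Φ I x • grad Ψ x

/-- The evolution equations for `φ`, `Q_I`, `f_{IJ}`, `Φ_I`, `Ψ` in spacetime dimension `D`, with
dilaton coupling `a` and three-metric `g`. The index `I` takes `n = D - 3` values. -/
structure EvolutionEquations (D : ℕ) (a : ℝ) (g : MetricField)
    (f : Coord → Matrix (Fin n) (Fin n) ℝ) (Q Φ : Fin n → Coord → ℝ) (Ψ φ : Coord → ℝ) :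
    Prop where
  dilaton : ∀ x ∈ dom,
    box g φ x = -(a / 2) *
      (Real.exp (-2 * a * φ x) * ∑ I, ∑ J, (f x)⁻¹ I J * ip g x (grad (Φ I) x) (grad (Φ J) x)
        - Real.exp (2 * a * φ x) * (f x).det⁻¹ * ip g x (grad Ψ x) (grad Ψ x))
  twist : ∀ x ∈ dom, ∀ I,
    box g (Q I) x =
      (f x).det⁻¹ * ip g x
        (grad (fun y => (f y).det) x + (Real.exp (2 * a * φ x) * Ψ x) • grad Ψ x)
        (twistCov Q Φ Ψ I x)
      + ∑ J, ∑ K, (f x)⁻¹ J K * ip g x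
        (grad (fun y => f y I J) x + (Real.exp (-2 * a * φ x) * Φ I x) • grad (Φ J) x)
        (twistCov Q Φ Ψ K x)
      + (f x).det⁻¹ * Φ I x * ip g x (grad (fun y => (f y).det) x) (grad Ψ x)
      - ∑ J, ∑ K, (f x)⁻¹ J K * Ψ x * ip g x (grad (fun y => f y I J) x) (grad (Φ K) x)
      - 2 * a * (Ψ x * ip g x (grad φ x) (grad (Φ I) x) + Φ I x * ip g x (grad φ x) (grad Ψ x))
  scalarMultiplet : ∀ x ∈ dom, ∀ I J,
    box g (fun y => f y I J) x =
      ∑ K, ∑ L, (f x)⁻¹ K L *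
        ip g x (grad (fun y => f y I K) x) (grad (fun y => f y J L) x)
      - (f x).det⁻¹ * ip g x (twistCov Q Φ Ψ I x) (twistCov Q Φ Ψ J x)
      - 2 * Real.exp (-2 * a * φ x) * ip g x (grad (Φ I) x) (grad (Φ J) x)
      + 2 / ((D : ℝ) - 2) * f x I J *
        (Real.exp (-2 * a * φ x) * ∑ K, ∑ L, (f x)⁻¹ K L * ip g x (grad (Φ K) x) (grad (Φ L) x)
          - Real.exp (2 * a * φ x) * (f x).det⁻¹ * ip g x (grad Ψ x) (grad Ψ x))
  maxwellPhi : ∀ x ∈ dom, ∀ I,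
    box g (Φ I) x =
      ∑ J, ∑ K, (f x)⁻¹ J K * ip g x (grad (fun y => f y I J) x) (grad (Φ K) x)
      - (f x).det⁻¹ * Real.exp (2 * a * φ x) * ip g x (grad Ψ x) (twistCov Q Φ Ψ I x)
      + 2 * a * ip g x (grad φ x) (grad (Φ I) x)
  maxwellPsi : ∀ x ∈ dom,
    box g Ψ x =
      (f x).det⁻¹ * ip g x (grad (fun y => (f y).det) x) (grad Ψ x)
      + Real.exp (-2 * a * φ x) *
        ∑ I, ∑ J, (f x)⁻¹ I J * ip g x (grad (Φ I) x) (twistCov Q Φ Ψ J x)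
      - 2 * a * ip g x (grad φ x) (grad Ψ x)

end Evolution

end EMD

end

/-! The positive definite cone is handled by Schur complements. A symmetric matrix is positive
definite iff its corner entry is positive and its Schur complement is positive definite
(`posDef_symMat_succ_iff`). By induction this gives both openness and a global chart: the logarithm
of the corner, the border, and the chart of the complement.

By Jacobi's formula the metric takes the matrix form `targetMetric_eq`, from which its positivity
and its derivative are read off. The geometric core is `targetMetric_force`: `force a u v` satisfies
`h(force, w) = 1/2 D_w h(v, v) - D_v h(v, w)`, so it is minus the Christoffel symbols contracted
with `v` twice.

For any target carrying such a force, the first variation of the action along `W` is `-2 ∫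
h(tension, W)`, the divergence term integrating to zero (`hasDerivAt_waveMapAction`). Taking a time
cutoff times the tension itself as variation shows that critical points are exactly the maps of
vanishing tension (`isWaveMap_iff_tension_eq_zero`).

The d'Alembertian enters through the conformal invariance of two-dimensional wave operators: `√(-det
γ) γ^{mm}` equals `√(-det η) η^{mm}` in the `t` and `θ` directions, and the `ψ` direction does not
contribute for `ψ`-independent maps. Hence, for each linear coordinate, `□` minus the `γ`-trace of
the force is a nonzero multiple of the tension (`box_gammaMetric`). The right-hand sides of the
evolution equations are these traces, component by component
(`evolutionEquations_iff_tension_eq_zero`). -/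

open scoped Matrix

noncomputable section

namespace EMD

/-! ### A global chart on the positive definite symmetric matrices -/

section Chart

variable {n : ℕ}

/-- The symmetric matrix with entries `m s(I, J)`. -/
def symMat (m : Sym2 (Fin n) → ℝ) : Matrix (Fin n) (Fin n) ℝ := Matrix.of fun I J => m s(I, J)

lemma symMat_apply (m : Sym2 (Fin n) → ℝ) (I J : Fin n) : symMat m I J = m s(I, J) := rfl

lemma symMat_isSymm (m : Sym2 (Fin n) → ℝ) : (symMat m).IsSymm := by
  ext I J
  simp [symMat_apply, Sym2.eq_swap]

/-- The off-diagonal part of the first row. -/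
def border (m : Sym2 (Fin (n + 1)) → ℝ) : Fin n → ℝ := fun I => m s(0, I.succ)

/-- The lower right block. -/
def core (m : Sym2 (Fin (n + 1)) → ℝ) : Sym2 (Fin n) → ℝ := fun z => m (z.map Fin.succ)

/-- The rank one symmetric matrix `b bᵀ`. -/
def rankOne (b : Fin n → ℝ) : Sym2 (Fin n) → ℝ := fun z => (z.map b).mul

/-- The Schur complement of the upper left entry. -/
def schur (m : Sym2 (Fin (n + 1)) → ℝ) : Sym2 (Fin n) → ℝ :=
  core m - (m s(0, 0))⁻¹ • rankOne (border m)

/-- The symmetric matrix with given corner, border and core. -/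
def assemble (c : ℝ) (b : Fin n → ℝ) (C : Sym2 (Fin n) → ℝ) : Sym2 (Fin (n + 1)) → ℝ :=
  Sym2.lift ⟨fun i j => Fin.cases (Fin.cases c b j) (fun i' => Fin.cases (b i')
    (fun j' => C s(i', j')) j) i, by
      intro i j
      refine Fin.cases ?_ (fun i' => ?_) i <;> refine Fin.cases ?_ (fun j' => ?_) j <;>
        simp [Sym2.eq_swap]⟩

@[simp] lemma assemble_corner (c : ℝ) (b : Fin n → ℝ) (C : Sym2 (Fin n) → ℝ) :
    assemble c b C s(0, 0) = c := rfl

@[simp] lemma border_assemble (c : ℝ) (b : Fin n → ℝ) (C : Sym2 (Fin n) → ℝ) :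
    border (assemble c b C) = b := rfl

@[simp] lemma core_assemble (c : ℝ) (b : Fin n → ℝ) (C : Sym2 (Fin n) → ℝ) :
    core (assemble c b C) = C := by
  funext z
  induction z with | _ i j => rfl

lemma assemble_eta (m : Sym2 (Fin (n + 1)) → ℝ) :
    assemble (m s(0, 0)) (border m) (core m) = m := by
  funext z
  induction z with | _ i j =>
  refine Fin.cases ?_ (fun i' => ?_) i <;> refine Fin.cases ?_ (fun j' => ?_) j
  · rfl
  · rfl
  · exact congrArg m Sym2.eq_swap
  · rfl

lemma posDef_symMat_iff (m : Sym2 (Fin n) → ℝ) :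
    (symMat m).PosDef ↔ ∀ x : Fin n → ℝ, x ≠ 0 → 0 < ∑ i, ∑ j, m s(i, j) * x i * x j := by
  rw [Matrix.posDef_iff_dotProduct_mulVec]
  have hH : (symMat m).IsHermitian := by
    rw [Matrix.IsHermitian, Matrix.conjTranspose_eq_transpose_of_trivial]
    exact symMat_isSymm m
  have hq : ∀ x : Fin n → ℝ,
      star x ⬝ᵥ (symMat m).mulVec x = ∑ i, ∑ j, m s(i, j) * x i * x j := by
    intro x
    simp only [dotProduct, Matrix.mulVec, Finset.mul_sum, symMat_apply]
    refine Finset.sum_congr rfl fun i _ => Finset.sum_congr rfl fun j _ => ?_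
    simp; ring
  exact ⟨fun h x hx => hq x ▸ h.2 hx, fun h => ⟨hH, fun x hx => (hq x).symm ▸ h x hx⟩⟩

/-- Completing the square in the variable `x 0`. -/
lemma quadForm_succ (m : Sym2 (Fin (n + 1)) → ℝ) (h : m s(0, 0) ≠ 0) (x : Fin (n + 1) → ℝ) :
    ∑ i, ∑ j, m s(i, j) * x i * x j =
      m s(0, 0) * (x 0 + (m s(0, 0))⁻¹ * ∑ i, border m i * x i.succ) ^ 2 +
        ∑ i, ∑ j, schur m s(i, j) * x i.succ * x j.succ := by
  have h1 : ∑ i, ∑ j, schur m s(i, j) * x i.succ * x j.succ =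
      ∑ i, ∑ j, core m s(i, j) * x (Fin.succ i) * x (Fin.succ j) -
        (m s(0, 0))⁻¹ * (∑ i, border m i * x i.succ) ^ 2 := by
    rw [sq, Finset.sum_mul_sum, Finset.mul_sum, ← Finset.sum_sub_distrib]
    refine Finset.sum_congr rfl fun i _ => ?_
    rw [Finset.mul_sum, ← Finset.sum_sub_distrib]
    refine Finset.sum_congr rfl fun j _ => ?_
    simp [schur, rankOne, Sym2.mul_mk]
    ring
  have h2 : ∑ i : Fin n, m s(i.succ, 0) * x i.succ * x 0 = x 0 * ∑ i, border m i * x i.succ := by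
    rw [Finset.mul_sum]
    refine Finset.sum_congr rfl fun i _ => ?_
    rw [border, Sym2.eq_swap]; ring
  have h3 : ∑ i : Fin n, m s(0, i.succ) * x 0 * x i.succ = x 0 * ∑ i, border m i * x i.succ := by
    rw [Finset.mul_sum]
    refine Finset.sum_congr rfl fun i _ => ?_
    rw [border]; ring
  rw [h1]
  simp only [Fin.sum_univ_succ, Finset.sum_add_distrib, h2, h3]
  simp only [core, Sym2.map_mk]
  field_simp
  ring

lemma posDef_symMat_succ_iff (m : Sym2 (Fin (n + 1)) → ℝ) :
    (symMat m).PosDef ↔ 0 < m s(0, 0) ∧ (symMat (schur m)).PosDef := by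
  constructor
  · intro hm
    have h0 : 0 < m s(0, 0) := hm.diag_pos (i := 0)
    refine ⟨h0, ?_⟩
    rw [posDef_symMat_iff] at hm ⊢
    intro y hy
    -- This first coordinate makes the completed square vanish, leaving only the form of the Schur
    -- complement.
    have hx := hm (Fin.cons (-((m s(0, 0))⁻¹ * ∑ i, border m i * y i)) y) (by
      intro h
      apply hy
      funext i
      simpa using congrFun h i.succ)
    rw [quadForm_succ m h0.ne'] at hx
    simpa using hx
  · rintro ⟨h0, hS⟩
    rw [posDef_symMat_iff] at hS ⊢
    intro x hx
    rw [quadForm_succ m h0.ne']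
    by_cases hy : (fun i : Fin n => x i.succ) = 0
    · have hy' : ∀ i : Fin n, x i.succ = 0 := fun i => congrFun hy i
      have hx0 : x 0 ≠ 0 := by
        intro h
        apply hx
        funext i
        exact Fin.cases h hy' i
      simp only [hy']
      simp only [mul_zero, Finset.sum_const_zero, add_zero]
      positivity
    · have := hS _ hy
      positivity

lemma contDiff_assemble {E : Type*} [NormedAddCommGroup E] [NormedSpace ℝ E] {s : Set E}
    {c : E → ℝ} {b : E → Fin n → ℝ} {C : E → Sym2 (Fin n) → ℝ} (hc : ContDiffOn ℝ ∞ c s)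
    (hb : ContDiffOn ℝ ∞ b s) (hC : ContDiffOn ℝ ∞ C s) :
    ContDiffOn ℝ ∞ (fun x => assemble (c x) (b x) (C x)) s := by
  rw [contDiffOn_pi] at hb hC ⊢
  intro z
  induction z with | _ i j =>
  refine Fin.cases ?_ (fun i' => ?_) i <;> refine Fin.cases ?_ (fun j' => ?_) j
  · exact hc
  · exact hb j'
  · exact hb i'
  · exact hC _

lemma contDiff_border : ContDiff ℝ ∞ (border (n := n)) := by
  unfold border; fun_prop

lemma contDiff_core : ContDiff ℝ ∞ (core (n := n)) := by
  unfold core; fun_prop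

lemma contDiff_rankOne : ContDiff ℝ ∞ (rankOne (n := n)) := by
  rw [contDiff_pi]
  intro z
  induction z with | _ i j =>
  simp only [rankOne, Sym2.map_mk, Sym2.mul_mk]
  fun_prop

lemma contDiffOn_schur : ContDiffOn ℝ ∞ (schur (n := n)) {m | 0 < m s(0, 0)} := by
  have h1 : ContDiffOn ℝ ∞ (fun m : Sym2 (Fin (n + 1)) → ℝ => (m s(0, 0))⁻¹)
      {m | 0 < m s(0, 0)} :=
    ContDiffOn.inv (by fun_prop) fun m hm => ne_of_gt hm
  exact contDiff_core.contDiffOn.sub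
    (h1.smul (contDiff_rankOne.comp contDiff_border).contDiffOn)

/-- Induction on the size: `schur` is continuous on the open half space where the corner is
positive, so a preimage under it intersected with that half space is open. -/
lemma isOpen_posDef_symMat : ∀ n : ℕ, IsOpen {m : Sym2 (Fin n) → ℝ | (symMat m).PosDef}
  | 0 => by
    convert isOpen_univ
    ext m
    simp only [Set.mem_ofPred_eq, Set.mem_univ, iff_true]
    rw [posDef_symMat_iff]
    exact fun x hx => absurd (Subsingleton.elim x 0) hx
  | n + 1 => by
    have hset : {m : Sym2 (Fin (n + 1)) → ℝ | (symMat m).PosDef} =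
        {m | 0 < m s(0, 0)} ∩ schur ⁻¹' {m | (symMat m).PosDef} := by
      ext m
      exact posDef_symMat_succ_iff m
    rw [hset]
    exact contDiffOn_schur.continuousOn.isOpen_inter_preimage
      (isOpen_lt continuous_const (by fun_prop)) (isOpen_posDef_symMat n)

/-- A recursive form of the Cholesky decomposition: corner and border are free once the corner is
written as an exponential, and the core is recovered from the Schur complement by adding back the
rank one term. -/
lemma exists_posDef_chart (n : ℕ) : ∃ e e' : (Sym2 (Fin n) → ℝ) → (Sym2 (Fin n) → ℝ),
    ContDiff ℝ ∞ e ∧ ContDiffOn ℝ ∞ e' {m | (symMat m).PosDef} ∧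
    (∀ y, (symMat (e y)).PosDef ∧ e' (e y) = y) ∧ ∀ m, (symMat m).PosDef → e (e' m) = m := by
  induction n with
  | zero =>
    refine ⟨id, id, contDiff_id, contDiffOn_id, fun y => ⟨?_, rfl⟩, fun _ _ => rfl⟩
    rw [posDef_symMat_iff]
    exact fun x hx => absurd (Subsingleton.elim x 0) hx
  | succ n ih =>
    obtain ⟨e, e', he, he', hee, hee'⟩ := ih
    have hschur : ∀ y : Sym2 (Fin (n + 1)) → ℝ,
        schur (assemble (Real.exp (y s(0, 0))) (border y)
          (e (core y) + (Real.exp (y s(0, 0)))⁻¹ • rankOne (border y))) = e (core y) := by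
      intro y
      simp [schur]
    refine ⟨fun y => assemble (Real.exp (y s(0, 0))) (border y)
        (e (core y) + (Real.exp (y s(0, 0)))⁻¹ • rankOne (border y)),
      fun m => assemble (Real.log (m s(0, 0))) (border m) (e' (schur m)), ?_, ?_, ?_, ?_⟩
    · rw [← contDiffOn_univ]
      have h1 : ContDiff ℝ ∞ (fun y : Sym2 (Fin (n + 1)) → ℝ => (Real.exp (y s(0, 0)))⁻¹) :=
        ContDiff.inv (by fun_prop) fun y => (Real.exp_pos _).ne'
      refine contDiff_assemble ?_ contDiff_border.contDiffOn ?_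
      · exact (show ContDiff ℝ ∞ (fun y : Sym2 (Fin (n + 1)) → ℝ => Real.exp (y s(0, 0))) by
          fun_prop).contDiffOn
      · exact ((he.comp contDiff_core).add
          (h1.smul (contDiff_rankOne.comp contDiff_border))).contDiffOn
    · refine contDiff_assemble ?_ contDiff_border.contDiffOn ?_
      · exact ContDiffOn.log (by fun_prop) fun m hm => ((posDef_symMat_succ_iff m).1 hm).1.ne'
      · refine he'.comp (contDiffOn_schur.mono fun m hm => ((posDef_symMat_succ_iff m).1 hm).1) ?_
        exact fun m hm => ((posDef_symMat_succ_iff m).1 hm).2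
    · intro y
      constructor
      · rw [posDef_symMat_succ_iff, hschur]
        exact ⟨by simpa using Real.exp_pos _, (hee _).1⟩
      · simp only [hschur, (hee _).2, assemble_corner, Real.log_exp, border_assemble]
        exact assemble_eta y
    · intro m hm
      obtain ⟨h0, hS⟩ := (posDef_symMat_succ_iff m).1 hm
      simp only [assemble_corner, border_assemble, core_assemble, Real.exp_log h0, hee' _ hS]
      rw [schur, sub_add_cancel]
      exact assemble_eta m

lemma targetSet_eq (n : ℕ) :
    targetSet n = Prod.fst ⁻¹' {m : Sym2 (Fin n) → ℝ | (symMat m).PosDef} := rfl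

lemma isOpen_targetSet (n : ℕ) : IsOpen (targetSet n) := by
  rw [targetSet_eq]
  exact (isOpen_posDef_symMat n).preimage continuous_fst

lemma finrank_target (n : ℕ) : Module.finrank ℝ (Target n) = (n + 1) * (n + 4) / 2 := by
  have h : Module.finrank ℝ (Target n) = (n + 1) * n / 2 + (n + (n + 2)) := by
    simp [Target, Sym2.card, Nat.choose_two_right]
  rw [h]
  have h2 : (n + 1) * (n + 4) = (n + 1) * n + 2 * (n + (n + 2)) := by ring
  rw [h2, Nat.add_mul_div_left _ _ two_pos]

/-- The chart on the matrix factor, the identity on the others, and a linear isomorphism from the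
dimension count. -/
lemma isDiffeomorphicToEuclidean_targetSet (n : ℕ) :
    IsDiffeomorphicToEuclidean (targetSet n) ((n + 1) * (n + 4) / 2) := by
  obtain ⟨e, e', he, he', hee, hee'⟩ := exists_posDef_chart n
  have hfr : Module.finrank ℝ (EuclideanSpace ℝ (Fin ((n + 1) * (n + 4) / 2))) =
      Module.finrank ℝ (Target n) := by
    rw [finrank_target, finrank_euclideanSpace_fin]
  let ι : EuclideanSpace ℝ (Fin ((n + 1) * (n + 4) / 2)) ≃L[ℝ] Target n :=
    ContinuousLinearEquiv.ofFinrankEq hfr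
  refine ⟨fun y => (e (ι y).1, (ι y).2), fun u => ι.symm (e' u.1, u.2), ?_, ?_, ?_, ?_⟩
  · exact ((he.comp (contDiff_fst.comp ι.contDiff)).prodMk (contDiff_snd.comp ι.contDiff))
  · refine ι.symm.contDiff.comp_contDiffOn (ContDiffOn.prodMk ?_ contDiffOn_snd)
    exact he'.comp contDiffOn_fst fun u hu => hu
  · exact fun y => ⟨(hee _).1, by simp [(hee _).2]⟩
  · intro u hu
    simp only [ContinuousLinearEquiv.apply_symm_apply, hee' _ hu]

end Chart

/-! ### Smoothness of matrix expressions -/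

section MatrixSmooth

variable {n : ℕ} {E : Type*} [NormedAddCommGroup E] [NormedSpace ℝ E]

lemma contDiffOn_det {s : Set E} {A : E → Matrix (Fin n) (Fin n) ℝ}
    (hA : ∀ i j, ContDiffOn ℝ ∞ (fun x => A x i j) s) :
    ContDiffOn ℝ ∞ (fun x => (A x).det) s := by
  simp only [Matrix.det_apply']
  exact ContDiffOn.sum fun σ _ => contDiffOn_const.mul (contDiffOn_prod fun i _ => hA _ _)

lemma contDiffOn_inv_apply {s : Set E} {A : E → Matrix (Fin n) (Fin n) ℝ}
    (hA : ∀ i j, ContDiffOn ℝ ∞ (fun x => A x i j) s) (hs : ∀ x ∈ s, (A x).det ≠ 0)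
    (i j : Fin n) : ContDiffOn ℝ ∞ (fun x => (A x)⁻¹ i j) s := by
  have h : ContDiffOn ℝ ∞ (fun x => ((A x).det)⁻¹ * (A x).adjugate i j) s := by
    refine ((contDiffOn_det hA).inv hs).mul ?_
    simp only [Matrix.adjugate_apply]
    refine contDiffOn_det fun k l => ?_
    simp only [Matrix.updateRow_apply]
    split_ifs
    · exact contDiffOn_const
    · exact hA k l
  refine h.congr fun x _ => ?_
  rw [Matrix.inv_def, Ring.inverse_eq_inv', Matrix.smul_apply, smul_eq_mul]

end MatrixSmooth

/-! ### Derivatives of matrix expressions along curves -/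

section MatrixDeriv

variable {n : ℕ} {t : ℝ}

lemma hasDerivAt_mul_apply {M N : ℝ → Matrix (Fin n) (Fin n) ℝ}
    {M' N' : Matrix (Fin n) (Fin n) ℝ}
    (hM : ∀ i j, HasDerivAt (fun s => M s i j) (M' i j) t)
    (hN : ∀ i j, HasDerivAt (fun s => N s i j) (N' i j) t) (i j : Fin n) :
    HasDerivAt (fun s => (M s * N s) i j) ((M' * N t + M t * N') i j) t := by
  simp only [Matrix.mul_apply, Matrix.add_apply, ← Finset.sum_add_distrib]
  exact HasDerivAt.fun_sum fun k _ => (hM i k).fun_mul (hN k j)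

lemma hasDerivAt_trace {M : ℝ → Matrix (Fin n) (Fin n) ℝ} {M' : Matrix (Fin n) (Fin n) ℝ}
    (hM : ∀ i j, HasDerivAt (fun s => M s i j) (M' i j) t) :
    HasDerivAt (fun s => (M s).trace) M'.trace t :=
  HasDerivAt.fun_sum fun k _ => hM k k

lemma hasDerivAt_dotProduct_mulVec {M : ℝ → Matrix (Fin n) (Fin n) ℝ}
    {M' : Matrix (Fin n) (Fin n) ℝ} {x y : ℝ → Fin n → ℝ} {x' y' : Fin n → ℝ}
    (hM : ∀ i j, HasDerivAt (fun s => M s i j) (M' i j) t)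
    (hx : ∀ i, HasDerivAt (fun s => x s i) (x' i) t)
    (hy : ∀ i, HasDerivAt (fun s => y s i) (y' i) t) :
    HasDerivAt (fun s => x s ⬝ᵥ (M s).mulVec (y s))
      (x' ⬝ᵥ (M t).mulVec (y t) + x t ⬝ᵥ M'.mulVec (y t) + x t ⬝ᵥ (M t).mulVec y') t := by
  have hv : ∀ i, HasDerivAt (fun s => (M s).mulVec (y s) i)
      (∑ j, (M' i j * y t j + M t i j * y' j)) t := by
    intro i
    change HasDerivAt (fun s => ∑ j, M s i j * y s j) _ t
    exact HasDerivAt.fun_sum fun j _ => (hM i j).fun_mul (hy j)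
  have h : HasDerivAt (fun s => x s ⬝ᵥ (M s).mulVec (y s))
      (∑ i, (x' i * ∑ j, M t i j * y t j + x t i * ∑ j, (M' i j * y t j + M t i j * y' j))) t :=
    HasDerivAt.fun_sum fun i _ => (hx i).fun_mul (hv i)
  convert h using 1
  simp only [dotProduct, Matrix.mulVec, Finset.sum_add_distrib, mul_add, add_assoc]

end MatrixDeriv

/-! ### The target metric -/

section Target

variable {n : ℕ} {a : ℝ} {u v w z : Target n}

lemma fMat_isSymm (u : Target n) : (fMat u)ᵀ = fMat u := symMat_isSymm u.1

lemma fMat_inv_isSymm (u : Target n) : ((fMat u)⁻¹)ᵀ = (fMat u)⁻¹ := by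
  rw [Matrix.transpose_nonsing_inv, fMat_isSymm]

lemma fDet_pos (hu : u ∈ targetSet n) : 0 < fDet u := Matrix.PosDef.det_pos hu

lemma isUnit_fDet (hu : u ∈ targetSet n) : IsUnit (fMat u).det := (fDet_pos hu).ne'.isUnit

lemma fMat_add (u v : Target n) : fMat (u + v) = fMat u + fMat v := rfl

lemma fMat_smul (c : ℝ) (v : Target n) : fMat (c • v) = c • fMat v := rfl

lemma contDiff_fMat (I J : Fin n) : ContDiff ℝ ∞ (fun u : Target n => fMat u I J) := by
  simp only [fMat, Matrix.of_apply]; fun_prop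

lemma contDiff_fDet : ContDiff ℝ ∞ (fDet (n := n)) :=
  contDiffOn_univ.1 (contDiffOn_det fun i j => (contDiff_fMat i j).contDiffOn)

lemma contDiffOn_fMat_inv (I J : Fin n) :
    ContDiffOn ℝ ∞ (fun u : Target n => (fMat u)⁻¹ I J) (targetSet n) :=
  contDiffOn_inv_apply (fun i j => (contDiff_fMat i j).contDiffOn)
    (fun _ hu => (fDet_pos hu).ne') I J

/-- Jacobi's formula. Factoring out `det f` leaves `det (1 + s f⁻¹ df)`, a polynomial in `s` whose
linear coefficient is the trace. -/
lemma hasLineDerivAt_fDet (hu : u ∈ targetSet n) (z : Target n) :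
    HasLineDerivAt ℝ fDet (fDet u * ((fMat u)⁻¹ * fMat z).trace) u z := by
  have h : ∀ s : ℝ, fDet (u + s • z) = fDet u * (1 + ((fMat u)⁻¹ * fMat z).trace * s +
      (Matrix.det (1 + (Polynomial.X : Polynomial ℝ) •
        ((fMat u)⁻¹ * fMat z).map Polynomial.C)).divX.divX.eval s * s ^ 2) := by
    intro s
    rw [← Matrix.det_one_add_smul, fDet, fDet, ← Matrix.det_mul, fMat_add, fMat_smul, mul_add,
      mul_one, Matrix.mul_smul, Matrix.mul_nonsing_inv_cancel_left _ _ (isUnit_fDet hu)]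
  rw [HasLineDerivAt]
  rw [funext h]
  have := (((hasDerivAt_id (0 : ℝ)).const_mul (((fMat u)⁻¹ * fMat z).trace)).const_add 1).add
    ((Polynomial.hasDerivAt (Matrix.det (1 + (Polynomial.X : Polynomial ℝ) •
        ((fMat u)⁻¹ * fMat z).map Polynomial.C)).divX.divX (0 : ℝ)).mul
      ((hasDerivAt_id (0 : ℝ)).pow 2))
  exact (this.const_mul (fDet u)).congr_deriv (by simp)

lemma fderiv_fDet (hu : u ∈ targetSet n) (z : Target n) :
    fderiv ℝ fDet u z = fDet u * ((fMat u)⁻¹ * fMat z).trace := by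
  rw [← (contDiff_fDet.differentiable (by simp) u).lineDeriv_eq_fderiv]
  exact (hasLineDerivAt_fDet hu z).lineDeriv

/-- Differentiability is known from the adjugate formula; the value of the derivative then follows
by differentiating `f⁻¹ f = 1`. -/
lemma hasLineDerivAt_fMat_inv (hu : u ∈ targetSet n) (z : Target n) (I J : Fin n) :
    HasDerivAt (fun s : ℝ => (fMat (u + s • z))⁻¹ I J)
      ((-((fMat u)⁻¹ * fMat z * (fMat u)⁻¹)) I J) 0 := by
  have hd : ∀ i j, DifferentiableAt ℝ (fun s : ℝ => (fMat (u + s • z))⁻¹ i j) 0 := by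
    intro i j
    have h1 : DifferentiableAt ℝ (fun y : Target n => (fMat y)⁻¹ i j) (u + (0 : ℝ) • z) := by
      rw [zero_smul, add_zero]
      exact ((contDiffOn_fMat_inv i j).contDiffAt
        ((isOpen_targetSet n).mem_nhds hu)).differentiableAt (by simp)
    exact DifferentiableAt.comp (0 : ℝ) (f := fun s : ℝ => u + s • z) h1 (by fun_prop)
  set M' : Matrix (Fin n) (Fin n) ℝ :=
    Matrix.of fun i j => deriv (fun s : ℝ => (fMat (u + s • z))⁻¹ i j) 0 with hM'
  have hM : ∀ i j, HasDerivAt (fun s : ℝ => (fMat (u + s • z))⁻¹ i j) (M' i j) 0 :=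
    fun i j => (hd i j).hasDerivAt
  have hF : ∀ i j, HasDerivAt (fun s : ℝ => fMat (u + s • z) i j) (fMat z i j) 0 := by
    intro i j
    simpa [fMat_add, fMat_smul] using
      ((hasDerivAt_id (0 : ℝ)).mul_const (fMat z i j)).const_add (fMat u i j)
  have hev : ∀ᶠ s : ℝ in nhds 0, u + s • z ∈ targetSet n := by
    have hc : Continuous fun s : ℝ => u + s • z := by fun_prop
    exact hc.continuousAt.eventually_mem ((isOpen_targetSet n).mem_nhds (by simpa using hu))
  have hzero : M' * fMat u + (fMat u)⁻¹ * fMat z = 0 := by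
    ext i j
    have h1 := hasDerivAt_mul_apply hM hF i j
    have h2 : HasDerivAt (fun s : ℝ => ((fMat (u + s • z))⁻¹ * fMat (u + s • z)) i j) 0 0 := by
      refine (hasDerivAt_const (0 : ℝ) ((1 : Matrix (Fin n) (Fin n) ℝ) i j)).congr_of_eventuallyEq
        ?_
      filter_upwards [hev] with s hs
      rw [Matrix.nonsing_inv_mul _ (isUnit_fDet hs)]
    simpa using h1.unique h2
  have hM'eq : M' = -((fMat u)⁻¹ * fMat z * (fMat u)⁻¹) := by
    have h3 : M' * fMat u = -((fMat u)⁻¹ * fMat z) := eq_neg_of_add_eq_zero_left hzero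
    rw [← Matrix.neg_mul, ← h3, Matrix.mul_nonsing_inv_cancel_right _ _ (isUnit_fDet hu)]
  rw [← hM'eq]
  exact hM I J

lemma sum_sum_eq_dotProduct_mulVec (P : Matrix (Fin n) (Fin n) ℝ) (x y : Fin n → ℝ) :
    ∑ I, ∑ J, P I J * x I * y J = x ⬝ᵥ P.mulVec y := by
  simp only [dotProduct, Matrix.mulVec, Finset.mul_sum]
  exact Finset.sum_congr rfl fun i _ => Finset.sum_congr rfl fun j _ => by ring

lemma sum_eq_trace_mul {P Y X : Matrix (Fin n) (Fin n) ℝ} 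
    (hP : Pᵀ = P) (hX : Xᵀ = X) :
    ∑ I, ∑ J, ∑ K, ∑ L, P I J * P K L * Y I K * X J L = (P * Y * P * X).trace := by
  have h : (P * Y * P * X).trace = ∑ J, ∑ L, ∑ K, ∑ I, P J I * Y I K * P K L * X L J := by
    simp only [Matrix.trace, Matrix.diag_apply, Matrix.mul_apply, Finset.sum_mul]
  rw [h, Finset.sum_comm]
  refine Finset.sum_congr rfl fun J _ => ?_
  have hswap : ∀ i j, P i j = P j i := fun i j => congrFun (congrFun hP j) i
  rw [Finset.sum_comm]
  rw [Finset.sum_congr rfl fun K _ => Finset.sum_comm, Finset.sum_comm]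
  refine Finset.sum_congr rfl fun L _ => Finset.sum_congr rfl fun K _ =>
    Finset.sum_congr rfl fun I _ => ?_
  rw [hswap I J, ← congrFun (congrFun hX J) L, Matrix.transpose_apply]
  ring

/-- The one-form `dQ_I + Ψ dΦ_I - Φ_I dΨ` as a vector. -/
def twistVec (u v : Target n) : Fin n → ℝ := tQ v + tPsi u • tPhi v - tPsi v • tPhi u

lemma twistForm_eq (u v : Target n) (I : Fin n) : twistForm u I v = twistVec u v I := by
  simp [twistForm, twistVec, mul_comm]

/-- Since `df = f tr(f⁻¹ df)`, the factor `f²` cancels in the first term and only traces and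
quadratic forms in `f⁻¹` remain. -/
lemma targetMetric_eq (a : ℝ) (hu : u ∈ targetSet n) (v w : Target n) :
    targetMetric a u v w =
      1 / 4 * (((fMat u)⁻¹ * fMat v).trace * ((fMat u)⁻¹ * fMat w).trace)
      + 1 / 4 * ((fMat u)⁻¹ * fMat v * (fMat u)⁻¹ * fMat w).trace
      + Real.exp (-2 * a * tDil u) * (tPhi v ⬝ᵥ (fMat u)⁻¹.mulVec (tPhi w))
      + Real.exp (2 * a * tDil u) * (fDet u)⁻¹ * (tPsi v * tPsi w)
      + 1 / 2 * (fDet u)⁻¹ * (twistVec u v ⬝ᵥ (fMat u)⁻¹.mulVec (twistVec u w))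
      + 2 * (tDil v * tDil w) := by
  have hf := (fDet_pos hu).ne'
  simp only [targetMetric, fderiv_fDet hu, twistForm_eq, sum_sum_eq_dotProduct_mulVec]
  rw [← sum_eq_trace_mul (fMat_inv_isSymm u) (fMat_isSymm w)]
  field_simp

end Target

section Target

variable {n : ℕ} {a : ℝ} {u v w z : Target n}

/-! ### The target metric is a smooth Riemannian metric -/

/-- Joint smoothness in all three arguments, which the chain rule along `(U, V, W)` requires. -/
lemma targetMetric_contDiffOn (a : ℝ) :
    ContDiffOn ℝ ∞ (fun p : Target n × Target n × Target n => targetMetric a p.1 p.2.1 p.2.2)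
      (targetSet n ×ˢ Set.univ) := by
  have hP : ∀ I J, ContDiffOn ℝ ∞
      (fun p : Target n × Target n × Target n => (fMat p.1)⁻¹ I J)
      (targetSet n ×ˢ Set.univ) := fun I J =>
    (contDiffOn_fMat_inv I J).comp contDiffOn_fst fun p hp => hp.1
  have hf : ContDiffOn ℝ ∞ (fun p : Target n × Target n × Target n => fDet p.1)
      (targetSet n ×ˢ Set.univ) := (contDiff_fDet.comp contDiff_fst).contDiffOn
  have hf0 : ∀ p ∈ (targetSet n ×ˢ Set.univ : Set (Target n × Target n × Target n)),
      fDet p.1 ≠ 0 := fun p hp => (fDet_pos hp.1).ne'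
  have hdf : ContDiff ℝ ∞ (fderiv ℝ (fDet (n := n))) := contDiff_fDet.fderiv_right (by simp)
  have hdf1 : ContDiff ℝ ∞
      (fun p : Target n × Target n × Target n => fderiv ℝ fDet p.1 p.2.1) :=
    (hdf.comp contDiff_fst).clm_apply (by fun_prop)
  have hdf2 : ContDiff ℝ ∞
      (fun p : Target n × Target n × Target n => fderiv ℝ fDet p.1 p.2.2) :=
    (hdf.comp contDiff_fst).clm_apply (by fun_prop)
  simp only [targetMetric, twistForm, fMat, Matrix.of_apply, tPhi, tQ, tPsi, tDil, div_eq_mul_inv,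
    one_mul, mul_inv] at hP ⊢
  refine ((((ContDiffOn.add ?_ ?_).add ?_).add ?_).add ?_).add ?_
  · exact (contDiffOn_const.mul ((hf.pow 2).inv fun p hp => pow_ne_zero 2 (hf0 p hp))).mul
      (hdf1.mul hdf2).contDiffOn
  · refine contDiffOn_const.mul (ContDiffOn.sum fun I _ => ContDiffOn.sum fun J _ =>
      ContDiffOn.sum fun K _ => ContDiffOn.sum fun L _ => ?_)
    exact (((hP I J).mul (hP K L)).mul (by fun_prop)).mul (by fun_prop)
  · refine ContDiffOn.mul (by fun_prop) (ContDiffOn.sum fun I _ => ContDiffOn.sum fun J _ => ?_)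
    exact ((hP I J).mul (by fun_prop)).mul (by fun_prop)
  · exact (ContDiffOn.mul (by fun_prop) (hf.inv hf0)).mul (by fun_prop)
  · refine (contDiffOn_const.mul (hf.inv hf0)).mul
      (ContDiffOn.sum fun I _ => ContDiffOn.sum fun J _ => ?_)
    exact ((hP I J).mul (by fun_prop)).mul (by fun_prop)
  · fun_prop

open scoped MatrixOrder Matrix.Norms.L2Operator in
lemma exists_eq_transpose_mul_self {P : Matrix (Fin n) (Fin n) ℝ} (hP : P.PosSemidef) :
    ∃ B : Matrix (Fin n) (Fin n) ℝ, P = Bᵀ * B := by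
  obtain ⟨B, hB⟩ := CStarAlgebra.nonneg_iff_eq_star_mul_self.mp hP.nonneg
  exact ⟨B, by rw [hB, Matrix.star_eq_conjTranspose,
    Matrix.conjTranspose_eq_transpose_of_trivial]⟩

/-- With `P = Bᵀ B` the trace is the squared Hilbert–Schmidt norm of `B Y Bᵀ`. -/
lemma trace_sq_nonneg {P Y : Matrix (Fin n) (Fin n) ℝ} (hP : P.PosDef) (hY : Yᵀ = Y) :
    0 ≤ (P * Y * P * Y).trace ∧ ((P * Y * P * Y).trace = 0 → Y = 0) := by
  obtain ⟨B, hB⟩ := exists_eq_transpose_mul_self hP.posSemidef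
  have hZ : (P * Y * P * Y).trace = ((B * Y * Bᵀ)ᴴ * (B * Y * Bᵀ)).trace := by
    have h : (B * Y * Bᵀ)ᴴ = B * Y * Bᵀ := by
      simp [Matrix.conjTranspose_eq_transpose_of_trivial, hY, Matrix.mul_assoc]
    rw [h, hB, Matrix.mul_assoc Bᵀ B Y, Matrix.mul_assoc Bᵀ (B * Y), Matrix.mul_assoc Bᵀ,
      Matrix.trace_mul_comm]
    simp only [Matrix.mul_assoc]
  rw [hZ]
  refine ⟨(Matrix.posSemidef_conjTranspose_mul_self _).trace_nonneg, fun h0 => ?_⟩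
  rw [Matrix.trace_conjTranspose_mul_self_eq_zero_iff] at h0
  have h1 : P * Y * P = 0 := by
    rw [hB]
    calc Bᵀ * B * Y * (Bᵀ * B) = Bᵀ * (B * Y * Bᵀ) * B := by simp only [Matrix.mul_assoc]
      _ = 0 := by simp [h0]
  have hd : IsUnit P.det := hP.det_pos.ne'.isUnit
  calc Y = P⁻¹ * (P * Y * P) * P⁻¹ := by
        rw [Matrix.mul_assoc P Y P, Matrix.nonsing_inv_mul_cancel_left _ _ hd,
          Matrix.mul_nonsing_inv_cancel_right _ _ hd]
    _ = 0 := by simp [h1]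

lemma dotProduct_mulVec_comm {P : Matrix (Fin n) (Fin n) ℝ} (hP : Pᵀ = P) (x y : Fin n → ℝ) :
    x ⬝ᵥ P.mulVec y = y ⬝ᵥ P.mulVec x := by
  rw [Matrix.dotProduct_mulVec, ← Matrix.mulVec_transpose, hP, dotProduct_comm]

lemma isRiemannianMetricOn_targetMetric (a : ℝ) :
    IsRiemannianMetricOn (targetMetric a) (targetSet n) where
  add_left u hu v v' w := by
    have h : twistVec u (v + v') = twistVec u v + twistVec u v' := by
      ext I; simp [twistVec, tQ, tPhi, tPsi]; ring
    have h1 : tPhi (v + v') = tPhi v + tPhi v' := rfl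
    have h2 : tPsi (v + v') = tPsi v + tPsi v' := rfl
    have h3 : tDil (v + v') = tDil v + tDil v' := rfl
    simp only [targetMetric_eq a hu, h, h1, h2, h3, fMat_add, mul_add, add_mul, Matrix.trace_add,
      add_dotProduct]
    ring
  smul_left u hu c v w := by
    have h : twistVec u (c • v) = c • twistVec u v := by
      ext I; simp [twistVec, tQ, tPhi, tPsi]; ring
    have h1 : tPhi (c • v) = c • tPhi v := rfl
    have h2 : tPsi (c • v) = c * tPsi v := rfl
    have h3 : tDil (c • v) = c * tDil v := rfl
    simp only [targetMetric_eq a hu, h, h1, h2, h3, fMat_smul, Matrix.mul_smul, Matrix.smul_mul,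
      Matrix.trace_smul, smul_dotProduct, smul_eq_mul]
    ring
  symm u hu v w := by
    have h : ((fMat u)⁻¹ * fMat v * (fMat u)⁻¹ * fMat w).trace =
        ((fMat u)⁻¹ * fMat w * (fMat u)⁻¹ * fMat v).trace := by
      rw [Matrix.mul_assoc ((fMat u)⁻¹ * fMat v), Matrix.trace_mul_comm]
      simp only [Matrix.mul_assoc]
    rw [targetMetric_eq a hu, targetMetric_eq a hu, h,
      dotProduct_mulVec_comm (fMat_inv_isSymm u) (tPhi v),
      dotProduct_mulVec_comm (fMat_inv_isSymm u) (twistVec u v)]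
    ring
  pos u hu v hv := by
    have hP : ((fMat u)⁻¹).PosDef := Matrix.PosDef.inv hu
    have hf := fDet_pos hu
    have hq : ∀ x : Fin n → ℝ, 0 ≤ x ⬝ᵥ (fMat u)⁻¹.mulVec x := fun x => by
      simpa using hP.posSemidef.dotProduct_mulVec_nonneg x
    have hq0 : ∀ x : Fin n → ℝ, x ⬝ᵥ (fMat u)⁻¹.mulVec x = 0 → x = 0 := fun x h => by
      by_contra hx
      have := hP.dotProduct_mulVec_pos hx
      simp only [star_trivial] at this
      exact this.ne' h
    obtain ⟨ht, ht0⟩ := trace_sq_nonneg hP (fMat_isSymm v)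
    rw [targetMetric_eq a hu]
    have e1 : 0 ≤ 1 / 4 * (((fMat u)⁻¹ * fMat v).trace * ((fMat u)⁻¹ * fMat v).trace) :=
      mul_nonneg (by norm_num) (mul_self_nonneg _)
    have e3 := mul_nonneg (Real.exp_pos (-2 * a * tDil u)).le (hq (tPhi v))
    have c4 : 0 < Real.exp (2 * a * tDil u) * (fDet u)⁻¹ := by positivity
    have e4 := mul_nonneg c4.le (mul_self_nonneg (tPsi v))
    have c5 : 0 < 1 / 2 * (fDet u)⁻¹ := by positivity
    have e5 := mul_nonneg c5.le (hq (twistVec u v))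
    have e6 := mul_self_nonneg (tDil v)
    -- All six summands are nonnegative, so if their sum is not positive each of them vanishes.
    by_contra hneg
    apply hv
    have z2 : ((fMat u)⁻¹ * fMat v * (fMat u)⁻¹ * fMat v).trace = 0 := by linarith
    have z3 : Real.exp (-2 * a * tDil u) * (tPhi v ⬝ᵥ (fMat u)⁻¹.mulVec (tPhi v)) = 0 := by
      linarith
    have z4 : Real.exp (2 * a * tDil u) * (fDet u)⁻¹ * (tPsi v * tPsi v) = 0 := by linarith
    have z5 : 1 / 2 * (fDet u)⁻¹ * (twistVec u v ⬝ᵥ (fMat u)⁻¹.mulVec (twistVec u v)) = 0 := by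
      linarith
    have z6 : tDil v * tDil v = 0 := by linarith
    have hPhi := hq0 _ ((mul_eq_zero.1 z3).resolve_left (Real.exp_pos _).ne')
    have hPsi := mul_self_eq_zero.1 ((mul_eq_zero.1 z4).resolve_left c4.ne')
    have hA := hq0 _ ((mul_eq_zero.1 z5).resolve_left c5.ne')
    -- Once `dΦ` and `dΨ` vanish, the twist form is just `dQ`.
    have hQ : tQ v = 0 := by simpa [twistVec, hPhi, hPsi] using hA
    have hF : v.1 = 0 := by
      funext s
      induction s with | _ I J => exact congrFun (congrFun (ht0 z2) I) J
    exact Prod.ext hF (Prod.ext hQ (Prod.ext hPhi (Prod.ext hPsi (mul_self_eq_zero.1 z6))))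
  smooth v w :=
    (targetMetric_contDiffOn a).comp (f := fun u => (u, v, w)) (by fun_prop)
      fun _ hu => ⟨hu, Set.mem_univ _⟩

end Target

section Target

variable {n : ℕ} {a : ℝ} {u v w z : Target n}

/-! ### The geodesic force of the target metric -/

/-- The directional derivative along `z` of the target metric, in terms of matrices. -/
def dTargetMetric (a : ℝ) (u v w z : Target n) : ℝ :=
  -(1 / 4) * (((fMat u)⁻¹ * fMat z * (fMat u)⁻¹ * fMat v).trace * ((fMat u)⁻¹ * fMat w).trace
      + ((fMat u)⁻¹ * fMat v).trace * ((fMat u)⁻¹ * fMat z * (fMat u)⁻¹ * fMat w).trace)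
  - 1 / 4 * (((fMat u)⁻¹ * fMat z * (fMat u)⁻¹ * fMat v * (fMat u)⁻¹ * fMat w).trace
      + ((fMat u)⁻¹ * fMat v * (fMat u)⁻¹ * fMat z * (fMat u)⁻¹ * fMat w).trace)
  + Real.exp (-2 * a * tDil u) * (-2 * a * tDil z * (tPhi v ⬝ᵥ (fMat u)⁻¹.mulVec (tPhi w))
      - tPhi v ⬝ᵥ ((fMat u)⁻¹ * fMat z * (fMat u)⁻¹).mulVec (tPhi w))
  + Real.exp (2 * a * tDil u) * (fDet u)⁻¹ * (tPsi v * tPsi w)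
      * (2 * a * tDil z - ((fMat u)⁻¹ * fMat z).trace)
  + 1 / 2 * (fDet u)⁻¹ *
      ((tPsi z • tPhi v - tPsi v • tPhi z) ⬝ᵥ (fMat u)⁻¹.mulVec (twistVec u w)
      - twistVec u v ⬝ᵥ ((fMat u)⁻¹ * fMat z * (fMat u)⁻¹).mulVec (twistVec u w)
      + twistVec u v ⬝ᵥ (fMat u)⁻¹.mulVec (tPsi z • tPhi w - tPsi w • tPhi z)
      - ((fMat u)⁻¹ * fMat z).trace * (twistVec u v ⬝ᵥ (fMat u)⁻¹.mulVec (twistVec u w)))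

lemma hasDerivAt_targetMetric_line (hu : u ∈ targetSet n) (v w z : Target n) :
    HasDerivAt (fun s : ℝ => targetMetric a (u + s • z) v w) (dTargetMetric a u v w z) 0 := by
  have hev : ∀ᶠ s : ℝ in nhds 0, u + s • z ∈ targetSet n := by
    have hc : Continuous fun s : ℝ => u + s • z := by fun_prop
    exact hc.continuousAt.eventually_mem ((isOpen_targetSet n).mem_nhds (by simpa using hu))
  refine HasDerivAt.congr_of_eventuallyEq ?_
    (hev.mono fun s hs => targetMetric_eq a hs v w)
  have hP := hasLineDerivAt_fMat_inv hu z
  have hc : ∀ Y : Matrix (Fin n) (Fin n) ℝ, ∀ i j,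
      HasDerivAt (fun _ : ℝ => Y i j) ((0 : Matrix (Fin n) (Fin n) ℝ) i j) 0 :=
    fun Y i j => hasDerivAt_const _ _
  have hPv := hasDerivAt_mul_apply hP (hc (fMat v))
  have hPw := hasDerivAt_mul_apply hP (hc (fMat w))
  have hT := hasDerivAt_trace (hasDerivAt_mul_apply (hasDerivAt_mul_apply hPv hP) (hc (fMat w)))
  have hdil : HasDerivAt (fun s : ℝ => tDil (u + s • z)) (tDil z) 0 := by
    simpa [tDil] using ((hasDerivAt_id (0 : ℝ)).mul_const (tDil z)).const_add (tDil u)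
  have hE := (hdil.const_mul (-2 * a)).exp
  have hG := (hdil.const_mul (2 * a)).exp
  have hdet := HasDerivAt.fun_inv (hasLineDerivAt_fDet hu z) (by simpa using (fDet_pos hu).ne')
  have htw : ∀ v : Target n, ∀ i, HasDerivAt (fun s : ℝ => twistVec (u + s • z) v i)
      ((tPsi z • tPhi v - tPsi v • tPhi z) i) 0 := by
    intro v i
    have h1 : HasDerivAt (fun s : ℝ => tQ v i + (tPsi u + s * tPsi z) * tPhi v i
        - tPsi v * (tPhi u i + s * tPhi z i)) (1 * tPsi z * tPhi v i
        - tPsi v * (1 * tPhi z i)) 0 :=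
      (((((hasDerivAt_id (0 : ℝ)).mul_const (tPsi z)).const_add (tPsi u)).mul_const
        (tPhi v i)).const_add (tQ v i)).sub
        ((((hasDerivAt_id (0 : ℝ)).mul_const (tPhi z i)).const_add (tPhi u i)).const_mul (tPsi v))
    exact h1.congr_deriv (by simp)
  have hpp := hasDerivAt_dotProduct_mulVec (x := fun _ => tPhi v) (y := fun _ => tPhi w)
    (x' := 0) (y' := 0) hP (fun _ => hasDerivAt_const _ _) (fun _ => hasDerivAt_const _ _)
  have hAB := hasDerivAt_dotProduct_mulVec hP (htw v) (htw w)
  have hsum := ((((((hasDerivAt_trace hPv).mul (hasDerivAt_trace hPw)).const_mul (1 / 4)).add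
    (hT.const_mul (1 / 4))).add (hE.mul hpp)).add ((hG.mul hdet).mul_const
      (tPsi v * tPsi w))).add ((hdet.const_mul (1 / 2)).mul hAB) |>.add_const
      (2 * (tDil v * tDil w))
  refine hsum.congr_deriv ?_
  have hf := (fDet_pos hu).ne'
  simp only [dTargetMetric, zero_smul, add_zero, Matrix.mul_zero, zero_dotProduct, zero_add,
    Matrix.mulVec_zero, dotProduct_zero, Matrix.neg_mul, Matrix.mul_neg, Matrix.trace_neg,
    Matrix.add_mul, Matrix.neg_mulVec, dotProduct_neg, Matrix.trace_add, Matrix.mul_assoc]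
  field_simp
  ring

lemma differentiableAt_targetMetric (hu : u ∈ targetSet n) (v w : Target n) :
    DifferentiableAt ℝ (fun y => targetMetric a y v w) u :=
  (((isRiemannianMetricOn_targetMetric a).smooth v w).contDiffAt
    ((isOpen_targetSet n).mem_nhds hu)).differentiableAt (by simp)

lemma fderiv_targetMetric (hu : u ∈ targetSet n) (v w z : Target n) :
    fderiv ℝ (fun y => targetMetric a y v w) u z = dTargetMetric a u v w z := by
  rw [← (differentiableAt_targetMetric hu v w).lineDeriv_eq_fderiv]
  exact HasLineDerivAt.lineDeriv (hasDerivAt_targetMetric_line hu v w z)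

/-- The quadratic form `e^{-2aφ} f^{IJ} dΦ_I dΦ_J - e^{2aφ} f^{-1} dΨ²`. -/
def forceDil (a : ℝ) (u v : Target n) : ℝ :=
  Real.exp (-2 * a * tDil u) * (tPhi v ⬝ᵥ (fMat u)⁻¹.mulVec (tPhi v))
    - Real.exp (2 * a * tDil u) * (fDet u)⁻¹ * tPsi v ^ 2

/-- The `f_{IJ}` component of the force. -/
def forceMat (a : ℝ) (u v : Target n) : Matrix (Fin n) (Fin n) ℝ :=
  fMat v * (fMat u)⁻¹ * fMat v
    - (fDet u)⁻¹ • Matrix.vecMulVec (twistVec u v) (twistVec u v)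
    - (2 * Real.exp (-2 * a * tDil u)) • Matrix.vecMulVec (tPhi v) (tPhi v)
    + (2 / ((n : ℝ) + 1) * forceDil a u v) • fMat u

/-- The `Φ_I` component of the force. -/
def forcePhi (a : ℝ) (u v : Target n) : Fin n → ℝ :=
  (fMat v * (fMat u)⁻¹).mulVec (tPhi v)
    - ((fDet u)⁻¹ * Real.exp (2 * a * tDil u) * tPsi v) • twistVec u v
    + (2 * a * tDil v) • tPhi v

/-- The `Ψ` component of the force. -/
def forcePsi (a : ℝ) (u v : Target n) : ℝ :=
  ((fMat u)⁻¹ * fMat v).trace * tPsi v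
    + Real.exp (-2 * a * tDil u) * (tPhi v ⬝ᵥ (fMat u)⁻¹.mulVec (twistVec u v))
    - 2 * a * tDil v * tPsi v

lemma forceMat_isSymm (a : ℝ) (u v : Target n) : (forceMat a u v)ᵀ = forceMat a u v := by
  simp [forceMat, Matrix.transpose_mul, fMat_isSymm, fMat_inv_isSymm, Matrix.mul_assoc,
    Matrix.transpose_vecMulVec]

/-- Minus the Christoffel symbols of the target metric, contracted twice with `v`. -/
def force (a : ℝ) (u v : Target n) : Target n :=
  (Sym2.lift ⟨fun I J => forceMat a u v I J, fun I J =>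
      (congrFun (congrFun (forceMat_isSymm a u v) J) I :)⟩,
    ((fMat u)⁻¹ * fMat v).trace • twistVec u v + (fMat v * (fMat u)⁻¹).mulVec (twistVec u v)
      - tPsi u • forcePhi a u v + forcePsi a u v • tPhi u,
    forcePhi a u v, forcePsi a u v, -(a / 2) * forceDil a u v)

lemma fMat_force : fMat (force a u v) = forceMat a u v := rfl

lemma tPhi_force : tPhi (force a u v) = forcePhi a u v := rfl

lemma tPsi_force : tPsi (force a u v) = forcePsi a u v := rfl

lemma tDil_force : tDil (force a u v) = -(a / 2) * forceDil a u v := rfl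

/-- The `Q` component of `force` carries the terms `-Ψ forcePhi + forcePsi Φ` precisely so that they
cancel here: the metric pairs the twist components only with each other. -/
lemma twistVec_force : twistVec u (force a u v) =
    ((fMat u)⁻¹ * fMat v).trace • twistVec u v + (fMat v * (fMat u)⁻¹).mulVec (twistVec u v) := by
  rw [twistVec, tPhi_force, tPsi_force]
  simp only [force, tQ]
  abel

/-- The Euler–Lagrange form of the geodesic equation. Both sides are reduced to a few traces and
quadratic forms by cyclicity of the trace and symmetry of `f⁻¹`, `df` and their products, and then
compared. -/
theorem targetMetric_force (hu : u ∈ targetSet n) (v w : Target n) :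
    targetMetric a u (force a u v) w =
      1 / 2 * fderiv ℝ (fun y => targetMetric a y v v) u w
        - fderiv ℝ (fun y => targetMetric a y v w) u v := by
  rw [fderiv_targetMetric hu, fderiv_targetMetric hu, targetMetric_eq a hu, fMat_force, tPhi_force,
    tPsi_force, tDil_force, twistVec_force]
  simp only [dTargetMetric, forceMat, forcePhi, forcePsi, forceDil]
  -- The cross terms between `Φ`, `Ψ` and the twist acquire both exponentials: one from the metric,
  -- the other from the force.
  have hEG : Real.exp (-2 * a * tDil u) * Real.exp (2 * a * tDil u) = 1 := by
    rw [← Real.exp_add]; simp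
  have hPF : (fMat u)⁻¹ * fMat u = 1 := Matrix.nonsing_inv_mul _ (isUnit_fDet hu)
  set P := (fMat u)⁻¹ with hP
  have hPs : Pᵀ = P := fMat_inv_isSymm u
  have hYs := fMat_isSymm v
  have hXs := fMat_isSymm w
  set Y := fMat v
  set X := fMat w
  set A := twistVec u v
  set B := twistVec u w
  have hcomm : ∀ {M : Matrix (Fin n) (Fin n) ℝ} (_ : Mᵀ = M) (x y : Fin n → ℝ),
    x ⬝ᵥ M.mulVec y = y ⬝ᵥ M.mulVec x := fun hM x y => dotProduct_mulVec_comm hM x y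
  have hPXP : (P * X * P)ᵀ = P * X * P := by
    simp [Matrix.transpose_mul, hPs, hXs, Matrix.mul_assoc]
  have hPYP : (P * Y * P)ᵀ = P * Y * P := by
    simp [Matrix.transpose_mul, hPs, hYs, Matrix.mul_assoc]
  have hv1 : ∀ x : Fin n → ℝ, (P * Matrix.vecMulVec x x).trace = x ⬝ᵥ P.mulVec x := by
    intro x
    rw [Matrix.mul_vecMulVec, Matrix.trace_vecMulVec, dotProduct_comm]
  have hv2 : ∀ x : Fin n → ℝ, (P * Matrix.vecMulVec x x * P * X).trace =
      x ⬝ᵥ (P * X * P).mulVec x := by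
    intro x
    rw [Matrix.mul_assoc, Matrix.trace_mul_comm, ← Matrix.mul_assoc, Matrix.mul_vecMulVec,
      Matrix.trace_vecMulVec, dotProduct_comm]
  have hv3 : ∀ x y : Fin n → ℝ, (Y * P).mulVec x ⬝ᵥ P.mulVec y = x ⬝ᵥ (P * Y * P).mulVec y := by
    intro x y
    rw [dotProduct_comm, Matrix.dotProduct_mulVec, ← Matrix.mulVec_transpose,
      Matrix.transpose_mul, hYs, hPs, Matrix.mulVec_mulVec, dotProduct_comm]
  have t1 : (P * X * P * Y).trace = (P * Y * P * X).trace := by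
    rw [Matrix.mul_assoc (P * X), Matrix.trace_mul_comm, ← Matrix.mul_assoc]
  have t2 : (P * X * P * Y * P * Y).trace = (P * Y * P * Y * P * X).trace := by
    have := Matrix.trace_mul_comm (P * X) (P * Y * P * Y)
    simpa only [← Matrix.mul_assoc] using this
  have t3 : (P * Y * P * X * P * Y).trace = (P * Y * P * Y * P * X).trace := by
    have := Matrix.trace_mul_comm (P * Y * P * X) (P * Y)
    simpa only [← Matrix.mul_assoc] using this
  have hn : ((n : ℝ) + 1) ≠ 0 := by positivity
  have hf := (fDet_pos hu).ne'
  simp only [Matrix.mul_add, Matrix.mul_sub, Matrix.mul_smul, Matrix.add_mul, Matrix.sub_mul,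
    Matrix.smul_mul, Matrix.trace_add, Matrix.trace_sub, Matrix.trace_smul, smul_eq_mul,
    add_dotProduct, sub_dotProduct, smul_dotProduct, dotProduct_sub, dotProduct_smul,
    Matrix.mulVec_sub, Matrix.mulVec_smul, ← Matrix.mul_assoc, hPF, Matrix.one_mul,
    Matrix.trace_one, Fintype.card_fin, hv1, hv2, hv3, t1, t2, t3, hcomm hPs (tPhi w) A,
    hcomm hPs A (tPhi v)]
  -- The multiple of `f` in `forceMat` enters through `tr 1 = n` in the product of traces and
  -- through `f⁻¹ f = 1` in the trace of the product. Together they give the factor `n + 1`, which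
  -- fixes the coefficient `2 / (n + 1)`.
  have hκ : 2 / ((n : ℝ) + 1) * n = 2 - 2 / ((n : ℝ) + 1) := by field_simp; ring
  linear_combination
    (fDet u)⁻¹ * (tPsi w * (tPhi v ⬝ᵥ P.mulVec A) - tPsi v * (A ⬝ᵥ P.mulVec (tPhi w))) * hEG +
    1 / 4 * (Real.exp (-2 * a * tDil u) * (tPhi v ⬝ᵥ P.mulVec (tPhi v))
      - Real.exp (2 * a * tDil u) * (fDet u)⁻¹ * tPsi v ^ 2) * (P * X).trace * hκ

end Target

/-! ### Smoothness of the geodesic force -/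

section ForceSmooth

variable {n : ℕ} {E : Type*} [NormedAddCommGroup E] [NormedSpace ℝ E] {s : Set E}

lemma contDiffOn_mul_apply {M N : E → Matrix (Fin n) (Fin n) ℝ}
    (hM : ∀ i j, ContDiffOn ℝ ∞ (fun x => M x i j) s)
    (hN : ∀ i j, ContDiffOn ℝ ∞ (fun x => N x i j) s) (i j : Fin n) :
    ContDiffOn ℝ ∞ (fun x => (M x * N x) i j) s := by
  simp only [Matrix.mul_apply]
  exact ContDiffOn.sum fun k _ => (hM i k).mul (hN k j)

lemma contDiffOn_mulVec_apply {M : E → Matrix (Fin n) (Fin n) ℝ} {y : E → Fin n → ℝ}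
    (hM : ∀ i j, ContDiffOn ℝ ∞ (fun x => M x i j) s)
    (hy : ∀ i, ContDiffOn ℝ ∞ (fun x => y x i) s) (i : Fin n) :
    ContDiffOn ℝ ∞ (fun x => (M x).mulVec (y x) i) s := by
  change ContDiffOn ℝ ∞ (fun x => ∑ j, M x i j * y x j) s
  exact ContDiffOn.sum fun k _ => (hM i k).mul (hy k)

lemma contDiffOn_dotProduct {x y : E → Fin n → ℝ}
    (hx : ∀ i, ContDiffOn ℝ ∞ (fun p => x p i) s)
    (hy : ∀ i, ContDiffOn ℝ ∞ (fun p => y p i) s) :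
    ContDiffOn ℝ ∞ (fun p => x p ⬝ᵥ y p) s :=
  ContDiffOn.sum fun k _ => (hx k).mul (hy k)

lemma contDiffOn_trace {M : E → Matrix (Fin n) (Fin n) ℝ}
    (hM : ∀ i j, ContDiffOn ℝ ∞ (fun x => M x i j) s) :
    ContDiffOn ℝ ∞ (fun x => (M x).trace) s :=
  ContDiffOn.sum fun k _ => hM k k

/-- This makes the tension field smooth, hence usable in a test variation. -/
lemma contDiffOn_force (a : ℝ) :
    ContDiffOn ℝ ∞ (fun p : Target n × Target n => force a p.1 p.2)
      (targetSet n ×ˢ Set.univ) := by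
  set S : Set (Target n × Target n) := targetSet n ×ˢ Set.univ
  have hP : ∀ I J, ContDiffOn ℝ ∞ (fun p : Target n × Target n => (fMat p.1)⁻¹ I J) S :=
    fun I J => (contDiffOn_fMat_inv I J).comp contDiffOn_fst fun p hp => hp.1
  have hF : ∀ I J, ContDiffOn ℝ ∞ (fun p : Target n × Target n => fMat p.1 I J) S :=
    fun I J => ((contDiff_fMat I J).comp contDiff_fst).contDiffOn
  have hY : ∀ I J, ContDiffOn ℝ ∞ (fun p : Target n × Target n => fMat p.2 I J) S :=
    fun I J => ((contDiff_fMat I J).comp contDiff_snd).contDiffOn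
  have hf : ContDiffOn ℝ ∞ (fun p : Target n × Target n => (fDet p.1)⁻¹) S :=
    ContDiffOn.inv (contDiff_fDet.comp contDiff_fst).contDiffOn
      fun p hp => (fDet_pos hp.1).ne'
  have hphi : ∀ I, ContDiffOn ℝ ∞ (fun p : Target n × Target n => tPhi p.2 I) S := by
    intro I; unfold tPhi; fun_prop
  have hphi1 : ∀ I, ContDiffOn ℝ ∞ (fun p : Target n × Target n => tPhi p.1 I) S := by
    intro I; unfold tPhi; fun_prop
  have hpsi : ContDiffOn ℝ ∞ (fun p : Target n × Target n => tPsi p.2) S := by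
    unfold tPsi; fun_prop
  have hpsi1 : ContDiffOn ℝ ∞ (fun p : Target n × Target n => tPsi p.1) S := by
    unfold tPsi; fun_prop
  have hdil : ContDiffOn ℝ ∞ (fun p : Target n × Target n => tDil p.2) S := by
    unfold tDil; fun_prop
  have hA : ∀ I, ContDiffOn ℝ ∞ (fun p : Target n × Target n => twistVec p.1 p.2 I) S := by
    intro I
    simp only [twistVec, tQ, tPsi, tPhi, Pi.add_apply, Pi.sub_apply, Pi.smul_apply, smul_eq_mul]
    fun_prop
  have hE : ContDiffOn ℝ ∞ (fun p : Target n × Target n => Real.exp (-2 * a * tDil p.1)) S := by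
    unfold tDil; fun_prop
  have hG : ContDiffOn ℝ ∞ (fun p : Target n × Target n => Real.exp (2 * a * tDil p.1)) S := by
    unfold tDil; fun_prop
  have hYP := contDiffOn_mul_apply hY hP
  have htr := contDiffOn_trace (contDiffOn_mul_apply hP hY)
  have hκ : ContDiffOn ℝ ∞ (fun p : Target n × Target n => forceDil a p.1 p.2) S :=
    (hE.mul (contDiffOn_dotProduct hphi (contDiffOn_mulVec_apply hP hphi))).sub
      ((hG.mul hf).mul (hpsi.pow 2))
  have hfphi : ContDiffOn ℝ ∞ (fun p : Target n × Target n => forcePhi a p.1 p.2) S :=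
    contDiffOn_pi.2 fun I => ((contDiffOn_mulVec_apply hYP hphi I).sub
      (((hf.mul hG).mul hpsi).mul (hA I))).add ((contDiffOn_const.mul hdil).mul (hphi I))
  have hfpsi : ContDiffOn ℝ ∞ (fun p : Target n × Target n => forcePsi a p.1 p.2) S :=
    ((htr.mul hpsi).add (hE.mul (contDiffOn_dotProduct hphi (contDiffOn_mulVec_apply hP hA)))).sub
      ((contDiffOn_const.mul hdil).mul hpsi)
  refine ContDiffOn.prodMk (contDiffOn_pi.2 fun z => ?_) (ContDiffOn.prodMk ?_
    (hfphi.prodMk (hfpsi.prodMk (contDiffOn_const.mul hκ))))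
  · induction z with | _ I J =>
    exact (((contDiffOn_mul_apply hYP hY I J).sub (hf.mul ((hA I).mul (hA J)))).sub
      ((contDiffOn_const.mul hE).mul ((hphi I).mul (hphi J)))).add
      ((contDiffOn_const.mul hκ).mul (hF I J))
  · exact contDiffOn_pi.2 fun I => (((htr.mul (hA I)).add
      (contDiffOn_mulVec_apply hYP hA I)).sub (hpsi1.mul (contDiffOn_pi.1 hfphi I))).add
      (hfpsi.mul (hphi1 I))

end ForceSmooth

/-! ### Smooth maps on `M` -/

section SmoothMaps

variable {E F G : Type*} [NormedAddCommGroup E] [NormedSpace ℝ E] [NormedAddCommGroup F]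
  [NormedSpace ℝ F] [NormedAddCommGroup G] [NormedSpace ℝ G]

lemma isOpen_dom : IsOpen dom := isOpen_lt continuous_const (continuous_apply 0)

lemma add_single_mem_dom {x : Coord} (hx : x ∈ dom) {m : Fin 3} (hm : m ≠ 0) (c : ℝ) :
    x + Pi.single m c ∈ dom := by
  simpa [dom, Pi.single_eq_of_ne hm.symm] using hx

lemma IsSmoothOnM.contDiffAt {u : Coord → E} (hu : IsSmoothOnM u) {x : Coord} (hx : x ∈ dom) :
    ContDiffAt ℝ ∞ u x := hu.smooth.contDiffAt (isOpen_dom.mem_nhds hx)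

lemma IsSmoothOnM.differentiableAt {u : Coord → E} (hu : IsSmoothOnM u) {x : Coord}
    (hx : x ∈ dom) : DifferentiableAt ℝ u x := (hu.contDiffAt hx).differentiableAt (by simp)

lemma IsSmoothOnM.periodic {u : Coord → E} (hu : IsSmoothOnM u) {m : Fin 3} (hm : m ≠ 0)
    {x : Coord} (hx : x ∈ dom) : u (x + Pi.single m (2 * Real.pi)) = u x := by
  fin_cases m
  · exact absurd rfl hm
  · exact hu.periodic_theta x hx
  · exact hu.periodic_psi x hx

lemma isSmoothOnM_of_periodic {u : Coord → E} (hu : ContDiffOn ℝ ∞ u dom)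
    (hp : ∀ m : Fin 3, m ≠ 0 → ∀ x ∈ dom, u (x + Pi.single m (2 * Real.pi)) = u x) :
    IsSmoothOnM u :=
  ⟨hu, hp 1 (by decide), hp 2 (by decide)⟩

lemma IsSmoothOnM.comp {u : Coord → E} (hu : IsSmoothOnM u) {g : E → F} {S : Set E}
    (hg : ContDiffOn ℝ ∞ g S) (hS : Set.MapsTo u dom S) : IsSmoothOnM fun x => g (u x) :=
  isSmoothOnM_of_periodic (hg.comp hu.smooth hS) fun _ hm x hx => by rw [hu.periodic hm hx]

lemma IsSmoothOnM.prodMk {u : Coord → E} {v : Coord → F} (hu : IsSmoothOnM u)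
    (hv : IsSmoothOnM v) : IsSmoothOnM fun x => (u x, v x) :=
  isSmoothOnM_of_periodic (hu.smooth.prodMk hv.smooth) fun _ hm x hx => by
    rw [hu.periodic hm hx, hv.periodic hm hx]

lemma IsSmoothOnM.smul {c : Coord → ℝ} {u : Coord → E} (hc : IsSmoothOnM c)
    (hu : IsSmoothOnM u) : IsSmoothOnM fun x => c x • u x :=
  (hc.prodMk hu).comp (g := fun p => p.1 • p.2) (S := Set.univ) (by fun_prop)
    (Set.mapsTo_univ _ _)

lemma IsSmoothOnM.sub {u v : Coord → E} (hu : IsSmoothOnM u) (hv : IsSmoothOnM v) :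
    IsSmoothOnM fun x => u x - v x :=
  (hu.prodMk hv).comp (g := fun p => p.1 - p.2) (S := Set.univ) (by fun_prop)
    (Set.mapsTo_univ _ _)

lemma IsSmoothOnM.sum {ι : Type*} {t : Finset ι} {u : ι → Coord → E}
    (hu : ∀ i, IsSmoothOnM (u i)) : IsSmoothOnM fun x => ∑ i ∈ t, u i x :=
  isSmoothOnM_of_periodic (ContDiffOn.sum fun i _ => (hu i).smooth) fun _ hm _ hx =>
    Finset.sum_congr rfl fun i _ => (hu i).periodic hm hx

lemma IsSmoothOnM.pd {u : Coord → E} (hu : IsSmoothOnM u) (k : Fin 3) :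
    IsSmoothOnM (pd k u) := by
  refine isSmoothOnM_of_periodic ?_ fun m hm x hx => ?_
  · exact (hu.smooth.fderiv_of_isOpen isOpen_dom (by simp)).clm_apply contDiffOn_const
  · have h : (fun y => u (y + Pi.single m (2 * Real.pi))) =ᶠ[nhds x] u :=
      Filter.eventually_of_mem (isOpen_dom.mem_nhds hx) fun y hy => hu.periodic hm hy
    simp only [EMD.pd]
    rw [← fderiv_comp_add_right, h.fderiv_eq]

lemma isSmoothOnM_of_time {g : ℝ → E} (hg : ContDiffOn ℝ ∞ g (Set.Ioi 0)) :
    IsSmoothOnM fun x => g (x 0) :=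
  isSmoothOnM_of_periodic (hg.comp (by fun_prop) fun _ hx => hx) fun m hm x _ => by
    simp [Pi.single_eq_of_ne hm.symm]

lemma pd_congr {u v : Coord → E} (h : ∀ x ∈ dom, u x = v x) (m : Fin 3) {x : Coord}
    (hx : x ∈ dom) : pd m u x = pd m v x := by
  have : u =ᶠ[nhds x] v := Filter.eventually_of_mem (isOpen_dom.mem_nhds hx) h
  rw [pd, pd, this.fderiv_eq]

lemma pd_clm (L : E →L[ℝ] F) {u : Coord → E} {x : Coord} (hu : DifferentiableAt ℝ u x)
    (m : Fin 3) : pd m (fun y => L (u y)) x = L (pd m u x) := by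
  have := (L.hasFDerivAt.comp x hu.hasFDerivAt).fderiv
  simp only [pd]
  rw [show (fun y => L (u y)) = L ∘ u from rfl, this]
  rfl

lemma pd_add_smul {u w : Coord → E} {x : Coord} (hu : DifferentiableAt ℝ u x)
    (hw : DifferentiableAt ℝ w x) (s : ℝ) (m : Fin 3) :
    pd m (fun y => u y + s • w y) x = pd m u x + s • pd m w x := by
  simp only [pd]
  rw [fderiv_fun_add hu (hw.fun_const_smul s), fderiv_fun_const_smul hw]
  rfl

/-- The action only sees angles in `[0, 2π]`; periodicity carries conclusions from there to all of
`dom`. -/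
lemma exists_mem_fundamental_domain {u : Coord → E} (hu : IsSmoothOnM u) {x : Coord}
    (hx : x ∈ dom) : ∃ y ∈ dom, y 0 = x 0 ∧ (∀ m ≠ 0, y m ∈ Set.Icc 0 (2 * Real.pi)) ∧
      u y = u x := by
  have key : ∀ z ∈ dom, ∀ m : Fin 3, m ≠ 0 → ∃ s : ℝ,
      z m + s ∈ Set.Icc 0 (2 * Real.pi) ∧ u (z + Pi.single m s) = u z := by
    intro z hz m hm
    have hper : Function.Periodic (fun s : ℝ => u (z + Pi.single m s)) (2 * Real.pi) := by
      intro s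
      simp only [Pi.single_add, ← add_assoc]
      exact hu.periodic hm (add_single_mem_dom hz hm s)
    obtain ⟨s, hs, hs'⟩ := hper.exists_mem_Ico Real.two_pi_pos 0 (-z m)
    refine ⟨s, ⟨by linarith [hs.1], by linarith [hs.2]⟩, ?_⟩
    simpa using hs'.symm
  obtain ⟨s, hs, hus⟩ := key x hx 1 (by decide)
  have hx1 := add_single_mem_dom hx (m := 1) (by decide) s
  obtain ⟨r, hr, hur⟩ := key _ hx1 2 (by decide)
  refine ⟨_, add_single_mem_dom hx1 (m := 2) (by decide) r, by simp, ?_, hur.trans hus⟩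
  intro m hm
  fin_cases m
  · exact absurd rfl hm
  · simpa using hs
  · simpa using hr

end SmoothMaps

/-! ### Differentiation under the integral sign and the divergence theorem -/

section Integrals

/-- The tube lemma yields a closed interval of parameters, uniform over `K`, on which the integrand
is defined and smooth. By compactness its derivative is bounded there, and dominated convergence
applies. -/
lemma hasDerivAt_setIntegral_of_contDiffOn {G : ℝ × Coord → ℝ} {Ω : Set (ℝ × Coord)}
    (hΩ : IsOpen Ω) (hG : ContDiffOn ℝ ∞ G Ω) {K : Set Coord} (hK : IsCompact K)
    (hKΩ : ∀ x ∈ K, ((0 : ℝ), x) ∈ Ω) :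
    HasDerivAt (fun s : ℝ => ∫ x in K, G (s, x)) (∫ x in K, fderiv ℝ G (0, x) (1, 0)) 0 := by
  obtain ⟨V, W, hV, -, hV0, hWK, hVW⟩ := generalized_tube_lemma (isCompact_singleton (x := (0 : ℝ)))
    hK hΩ (by rintro ⟨s, x⟩ ⟨rfl, hx⟩; exact hKΩ x hx)
  obtain ⟨ε, hε, hεV⟩ := Metric.isOpen_iff.1 hV 0 (hV0 rfl)
  have hsub : Metric.closedBall (0 : ℝ) (ε / 2) ×ˢ K ⊆ Ω := by
    rintro ⟨s, x⟩ ⟨hs, hx⟩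
    exact hVW ⟨hεV (Metric.closedBall_subset_ball (by linarith) hs), hWK hx⟩
  have hdG : ContinuousOn (fun p => fderiv ℝ G p (1, 0)) Ω :=
    (hG.continuousOn_fderiv_of_isOpen hΩ (by simp)).clm_apply continuousOn_const
  obtain ⟨C, hC⟩ := ((isCompact_closedBall (0 : ℝ) (ε / 2)).prod hK).exists_bound_of_continuousOn
    (hdG.mono hsub)
  have hslice : ∀ {f : ℝ × Coord → ℝ}, ContinuousOn f Ω → ∀ s ∈ Metric.closedBall (0 : ℝ) (ε / 2),
      ContinuousOn (fun x => f (s, x)) K := fun hf s hs =>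
    hf.comp (by fun_prop) fun x hx => hsub ⟨hs, hx⟩
  have h0 : (0 : ℝ) ∈ Metric.closedBall (0 : ℝ) (ε / 2) := Metric.mem_closedBall_self (by linarith)
  have hmeas : MeasurableSet K := hK.measurableSet
  refine (hasDerivAt_integral_of_dominated_loc_of_deriv_le
    (F' := fun s x => fderiv ℝ G (s, x) (1, 0)) (bound := fun _ => C)
    (Metric.closedBall_mem_nhds (0 : ℝ) (half_pos hε)) ?_ ?_ ?_ ?_ ?_ ?_).2
  · filter_upwards [Metric.closedBall_mem_nhds (0 : ℝ) (half_pos hε)] with s hs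
    exact (hslice hG.continuousOn s hs).aestronglyMeasurable hmeas
  · exact (hslice hG.continuousOn 0 h0).integrableOn_compact hK
  · exact (hslice hdG 0 h0).aestronglyMeasurable hmeas
  · filter_upwards [MeasureTheory.ae_restrict_mem hmeas] with x hx s hs
    exact hC (s, x) ⟨hs, hx⟩
  · exact MeasureTheory.integrableOn_const hK.measure_lt_top.ne
  · filter_upwards [MeasureTheory.ae_restrict_mem hmeas] with x hx s hs
    have hd : DifferentiableAt ℝ G (s, x) :=
      (hG.contDiffAt (hΩ.mem_nhds (hsub ⟨hs, hx⟩))).differentiableAt (by simp)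
    exact hd.hasFDerivAt.comp_hasDerivAt s
      ((hasDerivAt_id s).prodMk (hasDerivAt_const s x))

/-- The slab `[t₀, t₁] × T²`. -/
def slab (t₀ t₁ : ℝ) : Set Coord :=
  Set.Icc (![t₀, 0, 0] : Coord) ![t₁, 2 * Real.pi, 2 * Real.pi]

lemma mem_slab {t₀ t₁ : ℝ} {x : Coord} :
    x ∈ slab t₀ t₁ ↔ x 0 ∈ Set.Icc t₀ t₁ ∧ ∀ m ≠ 0, x m ∈ Set.Icc 0 (2 * Real.pi) := by
  simp only [slab, Set.mem_Icc, Pi.le_def, Fin.forall_fin_succ]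
  simp
  tauto

lemma isCompact_slab (t₀ t₁ : ℝ) : IsCompact (slab t₀ t₁) := isCompact_Icc

lemma slab_subset_dom {t₀ t₁ : ℝ} (h : 0 < t₀) : slab t₀ t₁ ⊆ dom :=
  fun _ hx => h.trans_le (mem_slab.1 hx).1.1

/-- The fluxes through the time faces vanish by hypothesis, and opposite angular faces cancel by
periodicity. -/
lemma integral_divergence_eq_zero {t₀ t₁ : ℝ} (h0 : 0 < t₀) (h1 : t₀ < t₁)
    {X : Fin 3 → Coord → ℝ} (hX : ∀ m, IsSmoothOnM (X m))
    (hz : ∀ x ∈ dom, x 0 = t₀ ∨ x 0 = t₁ → X 0 x = 0) :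
    ∫ x in slab t₀ t₁, ∑ m, pd m (X m) x = 0 := by
  have hdom := slab_subset_dom (t₁ := t₁) h0
  have hle : (![t₀, 0, 0] : Coord) ≤ ![t₁, 2 * Real.pi, 2 * Real.pi] := by
    intro i
    have := Real.two_pi_pos.le
    fin_cases i <;> simp [h1.le, Real.pi_pos.le]
  have key := MeasureTheory.integral_divergence_of_hasFDerivAt_off_countable'
    (![t₀, 0, 0] : Coord) ![t₁, 2 * Real.pi, 2 * Real.pi] hle X
    (fun m x => fderiv ℝ (X m) x) ∅ Set.countable_empty
    (fun m => (hX m).smooth.continuousOn.mono hdom)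
    (fun x hx m => ((hX m).differentiableAt (hdom ⟨fun i => (hx.1 i trivial).1.le,
      fun i => (hx.1 i trivial).2.le⟩)).hasFDerivAt) ?_
  · refine key.trans (Finset.sum_eq_zero fun m _ => ?_)
    rw [sub_eq_zero]
    refine MeasureTheory.setIntegral_congr_fun measurableSet_Icc fun y hy => ?_
    by_cases hm : m = 0
    · subst hm
      change X 0 _ = X 0 _
      rw [hz, hz]
      · simpa [dom] using h0
      · left; simp
      · simpa [dom] using h0.trans h1
      · right; simp
    · have hd : m.insertNth ((![t₀, 0, 0] : Coord) m) y ∈ dom := by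
        have h00 : (0 : Fin 3) = m.succAbove 0 := by
          fin_cases m
          · exact absurd rfl hm
          · rfl
          · rfl
        have h2 := hy.1 0
        rw [Function.comp_apply, ← h00] at h2
        change 0 < (m.insertNth ((![t₀, 0, 0] : Coord) m) y : Coord) 0
        rw [h00, Fin.insertNth_apply_succAbove]
        exact h0.trans_le h2
      have hshift : (m.insertNth ((![t₁, 2 * Real.pi, 2 * Real.pi] : Coord) m) y : Coord) =
          m.insertNth ((![t₀, 0, 0] : Coord) m) y + Pi.single m (2 * Real.pi) := by
        ext k
        rcases Fin.eq_self_or_eq_succAbove m k with rfl | ⟨j, rfl⟩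
        · fin_cases k
          · exact absurd rfl hm
          · simp
          · simp
        · simp
      change X m _ = X m _
      rw [hshift, (hX m).periodic hm hd]
  · have hc : ContinuousOn (fun x => ∑ m, pd m (X m) x) (slab t₀ t₁) :=
      continuousOn_finsetSum _ fun m _ => ((hX m).pd m).smooth.continuousOn.mono hdom
    exact hc.integrableOn_compact (isCompact_slab t₀ t₁)

end Integrals

/-! ### The wave map equation -/

section WaveMap

variable {E : Type*} [NormedAddCommGroup E] [NormedSpace ℝ E]

/-- The diagonal coefficients `√(- det η) η^{mm}`. -/
def etaCoeff (m : Fin 3) (x : Coord) : ℝ := ![-x 0, x 0, (x 0)⁻¹] m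

lemma isSmoothOnM_etaCoeff (m : Fin 3) : IsSmoothOnM (etaCoeff m) := by
  fin_cases m
  · exact isSmoothOnM_of_time (g := fun t => -t) (by fun_prop)
  · exact isSmoothOnM_of_time (g := fun t => t) (by fun_prop)
  · exact isSmoothOnM_of_time (g := fun t => t⁻¹)
      (contDiffOn_id.inv fun t ht => (Set.mem_Ioi.1 ht).ne')

lemma volDensity_etaMetric {x : Coord} (hx : x ∈ dom) : volDensity etaMetric x = x 0 := by
  have h : -(etaMetric x).det = x 0 ^ 2 := by
    simp [etaMetric, Matrix.det_diagonal, Fin.prod_univ_three]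
  rw [volDensity, h, Real.sqrt_sq (le_of_lt hx)]

lemma etaMetric_inv {x : Coord} (hx : x ∈ dom) :
    (etaMetric x)⁻¹ = Matrix.diagonal ![-1, 1, (x 0 ^ 2)⁻¹] := by
  have hx0 : x 0 ≠ 0 := ne_of_gt hx
  refine Matrix.inv_eq_right_inv ?_
  rw [etaMetric, Matrix.diagonal_mul_diagonal, ← Matrix.diagonal_one]
  congr 1
  ext i
  fin_cases i <;> simp [hx0]

lemma waveMapLagrangian_etaMetric (h : E → E → E → ℝ) (U : Coord → E) {x : Coord} (hx : x ∈ dom) :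
    waveMapLagrangian etaMetric h U x = ∑ m, etaCoeff m x * h (U x) (pd m U x) (pd m U x) := by
  have hx0 : x 0 ≠ 0 := ne_of_gt hx
  rw [waveMapLagrangian, volDensity_etaMetric hx, etaMetric_inv hx]
  simp only [Fin.sum_univ_three, Matrix.diagonal_apply, etaCoeff]
  simp
  field_simp

/-! ### Bilinearity of the metric and its total derivative -/

section Bilinear

variable {N : Set E} {h : E → E → E → ℝ}

lemma IsRiemannianMetricOn.add_right (hh : IsRiemannianMetricOn h N) {u : E} (hu : u ∈ N)
    (v w w' : E) : h u v (w + w') = h u v w + h u v w' := by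
  rw [hh.symm u hu, hh.add_left u hu, hh.symm u hu w, hh.symm u hu w']

lemma IsRiemannianMetricOn.smul_right (hh : IsRiemannianMetricOn h N) {u : E} (hu : u ∈ N)
    (c : ℝ) (v w : E) : h u v (c • w) = c * h u v w := by
  rw [hh.symm u hu, hh.smul_left u hu, hh.symm u hu w]

lemma IsRiemannianMetricOn.zero_left (hh : IsRiemannianMetricOn h N) {u : E} (hu : u ∈ N)
    (w : E) : h u 0 w = 0 := by
  simpa using hh.smul_left u hu 0 0 w

lemma IsRiemannianMetricOn.sub_left (hh : IsRiemannianMetricOn h N) {u : E} (hu : u ∈ N)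
    (v v' w : E) : h u (v - v') w = h u v w - h u v' w := by
  rw [eq_sub_iff_add_eq, ← hh.add_left u hu, sub_add_cancel]

lemma IsRiemannianMetricOn.sum_left (hh : IsRiemannianMetricOn h N) {u : E} (hu : u ∈ N)
    {ι : Type*} (t : Finset ι) (v : ι → E) (w : E) :
    h u (∑ i ∈ t, v i) w = ∑ i ∈ t, h u (v i) w := by
  classical
  induction t using Finset.induction_on with
  | empty => simpa using hh.zero_left hu w
  | insert i t hi ih => rw [Finset.sum_insert hi, Finset.sum_insert hi, hh.add_left u hu, ih]

/-- The total derivative splits into its three partials; the last two are explicit by linearity in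
the tangent arguments. -/
lemma IsRiemannianMetricOn.fderiv_uncurried (hh : IsRiemannianMetricOn h N) (hN : IsOpen N)
    (hs : ContDiffOn ℝ ∞ (fun p : E × E × E => h p.1 p.2.1 p.2.2) (N ×ˢ Set.univ))
    {u : E} (hu : u ∈ N) (v w u' v' w' : E) :
    fderiv ℝ (fun p : E × E × E => h p.1 p.2.1 p.2.2) (u, v, w) (u', v', w') =
      fderiv ℝ (fun y => h y v w) u u' + h u v' w + h u v w' := by
  set H : E × E × E → ℝ := fun p => h p.1 p.2.1 p.2.2
  have hd : DifferentiableAt ℝ H (u, v, w) :=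
    (hs.contDiffAt ((hN.prod isOpen_univ).mem_nhds ⟨hu, trivial⟩)).differentiableAt (by simp)
  have hsplit : ((u', v', w') : E × E × E) = (u', 0, 0) + ((0, v', 0) + (0, 0, w')) := by simp
  have h1 : fderiv ℝ H (u, v, w) (u', 0, 0) = fderiv ℝ (fun y => h y v w) u u' := by
    have hc := hd.hasFDerivAt.comp (f := fun y : E => (y, v, w)) u
      ((hasFDerivAt_id u).prodMk (hasFDerivAt_const (v, w) u))
    rw [show (fun y => h y v w) = H ∘ fun y : E => (y, v, w) from rfl, hc.fderiv]
    rfl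
  have h2 : fderiv ℝ H (u, v, w) (0, v', 0) = h u v' w := by
    have hc := (hd.hasFDerivAt.hasLineDerivAt (0, v', 0)).unique (f₁' := h u v' w) (by
      simp only [HasLineDerivAt, H, Prod.smul_mk, smul_zero, Prod.mk_add_mk, add_zero,
        hh.add_left u hu, hh.smul_left u hu]
      simpa using ((hasDerivAt_id (0 : ℝ)).mul_const (h u v' w)).const_add (h u v w))
    exact hc
  have h3 : fderiv ℝ H (u, v, w) (0, 0, w') = h u v w' := by
    have hc := (hd.hasFDerivAt.hasLineDerivAt (0, 0, w')).unique (f₁' := h u v w') (by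
      simp only [HasLineDerivAt, H, Prod.smul_mk, smul_zero, Prod.mk_add_mk, add_zero,
        hh.add_right hu, hh.smul_right hu]
      simpa using ((hasDerivAt_id (0 : ℝ)).mul_const (h u v w')).const_add (h u v w))
    exact hc
  rw [hsplit, map_add, map_add, h1, h2, h3, add_assoc]

end Bilinear

/-- The data of a Riemannian target: a metric `h` on the open set `N`, jointly smooth in all its
arguments, and the quadratic form `r` of its geodesic equation `u'' = r u u'`. -/
structure GeodesicForce (N : Set E) (h : E → E → E → ℝ) (r : E → E → E) : Prop where
  isOpen : IsOpen N
  metric : IsRiemannianMetricOn h N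
  contDiffOn_metric : ContDiffOn ℝ ∞ (fun p : E × E × E => h p.1 p.2.1 p.2.2) (N ×ˢ Set.univ)
  contDiffOn_force : ContDiffOn ℝ ∞ (fun p : E × E => r p.1 p.2) (N ×ˢ Set.univ)
  force_eq : ∀ u ∈ N, ∀ v w, h u (r u v) w =
    1 / 2 * fderiv ℝ (fun y => h y v v) u w - fderiv ℝ (fun y => h y v w) u v

/-- The tension field of `U`, multiplied by `√(- det η)`. -/
def tension (r : E → E → E) (U : Coord → E) (x : Coord) : E :=
  ∑ m, (pd m (fun y => etaCoeff m y • pd m U y) x - etaCoeff m x • r (U x) (pd m U x))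

variable {N : Set E} {h : E → E → E → ℝ} {r : E → E → E} {U : Coord → E}

lemma isSmoothOnM_tension (hr : GeodesicForce N h r) (hU : IsSmoothOnM U)
    (hUN : Set.MapsTo U dom N) : IsSmoothOnM (tension r U) :=
  IsSmoothOnM.sum fun m => ((((isSmoothOnM_etaCoeff m).smul (hU.pd m))).pd m).sub
    ((isSmoothOnM_etaCoeff m).smul ((hU.prodMk (hU.pd m)).comp hr.contDiffOn_force
      fun _ hx => ⟨hUN hx, trivial⟩))

lemma pd_metric (hr : GeodesicForce N h r) {V W : Coord → E} (hU : IsSmoothOnM U)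
    (hV : IsSmoothOnM V) (hW : IsSmoothOnM W) {x : Coord} (hx : x ∈ dom) (hUx : U x ∈ N)
    (m : Fin 3) :
    pd m (fun y => h (U y) (V y) (W y)) x =
      fderiv ℝ (fun y => h y (V x) (W x)) (U x) (pd m U x)
        + h (U x) (pd m V x) (W x) + h (U x) (V x) (pd m W x) := by
  have hd : DifferentiableAt ℝ (fun p : E × E × E => h p.1 p.2.1 p.2.2) (U x, V x, W x) :=
    (hr.contDiffOn_metric.contDiffAt
      ((hr.isOpen.prod isOpen_univ).mem_nhds ⟨hUx, trivial⟩)).differentiableAt (by simp)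
  have hc := hd.hasFDerivAt.comp x ((hU.differentiableAt hx).hasFDerivAt.prodMk
    ((hV.differentiableAt hx).hasFDerivAt.prodMk (hW.differentiableAt hx).hasFDerivAt))
  rw [← hr.metric.fderiv_uncurried hr.isOpen hr.contDiffOn_metric hUx, pd,
    show (fun y => h (U y) (V y) (W y)) = (fun p : E × E × E => h p.1 p.2.1 p.2.2) ∘
      fun y => (U y, V y, W y) from rfl, hc.fderiv]
  rfl

/-- The support condition speaks only of times outside the closed interval. At the end points `W`
vanishes by continuity, approaching from outside. -/
lemma variation_eq_zero_of_boundary {t₀ t₁ : ℝ} {W : Coord → E} (hW : IsSmoothOnM W)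
    (hsupp : ∀ x ∈ dom, x 0 ∉ Set.Icc t₀ t₁ → W x = 0) {x : Coord} (hx : x ∈ dom)
    (hx0 : x 0 = t₀ ∨ x 0 = t₁) : W x = 0 := by
  have hlim : ∀ σ : ℝ, Filter.Tendsto (fun δ : ℝ => x + Pi.single 0 (σ * δ))
      (nhdsWithin 0 (Set.Ioi 0)) (nhds x) := by
    intro σ
    have hc : Continuous fun δ : ℝ => x + Pi.single (M := fun _ : Fin 3 => ℝ) 0 (σ * δ) :=
      continuous_const.add ((continuous_single 0).comp (continuous_const.mul continuous_id))
    have := hc.tendsto 0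
    simp only [mul_zero, Pi.single_zero, add_zero] at this
    exact this.mono_left nhdsWithin_le_nhds
  have main : ∀ σ : ℝ, (∀ δ > 0, x 0 + σ * δ ∉ Set.Icc t₀ t₁) → W x = 0 := by
    intro σ hσ
    have h1 := ((hW.contDiffAt hx).continuousAt.tendsto.comp (hlim σ))
    refine tendsto_nhds_unique h1 (tendsto_const_nhds.congr' ?_)
    filter_upwards [self_mem_nhdsWithin, (hlim σ).eventually_mem (isOpen_dom.mem_nhds hx)]
      with δ hδ hδ'
    exact (hsupp _ hδ' (by simpa using hσ δ hδ)).symm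
  rcases hx0 with hx0 | hx0
  · exact main (-1) fun δ hδ hmem => by linarith [hmem.1]
  · exact main 1 fun δ hδ hmem => by linarith [hmem.2]

/-- The first variation formula. Pointwise the varied Lagrangian is twice the divergence of `h(c_m
∂_m U, W)`, with `c_m = etaCoeff m`, minus `2 h(tension, W)`; the divergence integrates to zero. -/
theorem hasDerivAt_waveMapAction (hr : GeodesicForce N h r) (hU : IsSmoothOnM U)
    (hUN : Set.MapsTo U dom N) {t₀ t₁ : ℝ} (h0 : 0 < t₀) (h1 : t₀ < t₁) {W : Coord → E}
    (hW : IsSmoothOnM W) (hsupp : ∀ x ∈ dom, x 0 ∉ Set.Icc t₀ t₁ → W x = 0) :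
    HasDerivAt (fun s : ℝ => waveMapAction etaMetric h t₀ t₁ fun x => U x + s • W x)
      (-2 * ∫ x in slab t₀ t₁, h (U x) (tension r U x) (W x)) 0 := by
  have hdom := slab_subset_dom (t₁ := t₁) h0
  set G : ℝ × Coord → ℝ := fun p => ∑ m, etaCoeff m p.2 * h (U p.2 + p.1 • W p.2)
    (pd m U p.2 + p.1 • pd m W p.2) (pd m U p.2 + p.1 • pd m W p.2) with hGdef
  have hline : ∀ {u w : Coord → E}, IsSmoothOnM u → IsSmoothOnM w →
      ContDiffOn ℝ ∞ (fun p : ℝ × Coord => u p.2 + p.1 • w p.2) (Set.univ ×ˢ dom) := by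
    intro u w hu hw
    exact (hu.smooth.comp contDiffOn_snd fun p hp => hp.2).add
      (contDiffOn_fst.smul (hw.smooth.comp contDiffOn_snd fun p hp => hp.2))
  -- The varied map need not stay in `N` for every `s`; this open set records where it does, and it
  -- contains the slab at `s = 0`.
  set Ω : Set (ℝ × Coord) :=
    (Set.univ ×ˢ dom) ∩ (fun p : ℝ × Coord => U p.2 + p.1 • W p.2) ⁻¹' N with hΩdef
  have hΩ : IsOpen Ω := (hline hU hW).continuousOn.isOpen_inter_preimage
    (isOpen_univ.prod isOpen_dom) hr.isOpen
  have hG : ContDiffOn ℝ ∞ G Ω := by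
    refine ContDiffOn.sum fun m _ => ?_
    have hsub : Ω ⊆ Set.univ ×ˢ dom := Set.inter_subset_left
    have hV := (hline (hU.pd m) (hW.pd m)).mono hsub
    refine ((isSmoothOnM_etaCoeff m).smooth.comp contDiffOn_snd fun p hp => hp.1.2).mul ?_
    exact hr.contDiffOn_metric.comp (((hline hU hW).mono hsub).prodMk (hV.prodMk hV))
      fun p hp => ⟨hp.2, trivial⟩
  have hKΩ : ∀ x ∈ slab t₀ t₁, ((0 : ℝ), x) ∈ Ω := fun x hx =>
    ⟨⟨trivial, hdom hx⟩, by simpa using hUN (hdom hx)⟩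
  have hmain := hasDerivAt_setIntegral_of_contDiffOn hΩ hG (isCompact_slab t₀ t₁) hKΩ
  have haction : (fun s : ℝ => waveMapAction etaMetric h t₀ t₁ fun x => U x + s • W x) =
      fun s => ∫ x in slab t₀ t₁, G (s, x) := by
    funext s
    refine MeasureTheory.setIntegral_congr_fun measurableSet_Icc fun x hx => ?_
    have hxd := hdom hx
    change waveMapLagrangian etaMetric h (fun x => U x + s • W x) x = G (s, x)
    rw [waveMapLagrangian_etaMetric _ _ hxd]
    simp only [hGdef, pd_add_smul (hU.differentiableAt hxd) (hW.differentiableAt hxd)]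
  set X : Fin 3 → Coord → ℝ := fun m x => h (U x) (etaCoeff m x • pd m U x) (W x) with hXdef
  have hcV : ∀ m, IsSmoothOnM fun x => etaCoeff m x • pd m U x :=
    fun m => (isSmoothOnM_etaCoeff m).smul (hU.pd m)
  have hX : ∀ m, IsSmoothOnM (X m) := fun m =>
    (hU.prodMk ((hcV m).prodMk hW)).comp hr.contDiffOn_metric fun _ hx => ⟨hUN hx, trivial⟩
  have hdiv : ∫ x in slab t₀ t₁, ∑ m, pd m (X m) x = 0 := by
    refine integral_divergence_eq_zero h0 h1 hX fun x hx hx0 => ?_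
    rw [hXdef]
    simp only [variation_eq_zero_of_boundary hW hsupp hx hx0]
    rw [hr.metric.symm _ (hUN hx), hr.metric.zero_left (hUN hx)]
  have hpt : ∀ x ∈ slab t₀ t₁, fderiv ℝ G (0, x) (1, 0) =
      2 * ∑ m, pd m (X m) x - 2 * h (U x) (tension r U x) (W x) := by
    intro x hx
    have hxd := hdom hx
    have hUx := hUN hxd
    have hGd : DifferentiableAt ℝ G (0, x) :=
      (hG.contDiffAt (hΩ.mem_nhds (hKΩ x hx))).differentiableAt (by simp)
    have hlineder : ∀ a b : E, HasDerivAt (fun s : ℝ => a + s • b) b 0 := fun a b => by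
      simpa using ((hasDerivAt_id (0 : ℝ)).smul_const b).const_add a
    have hterm : ∀ m, HasDerivAt (fun s : ℝ => h (U x + s • W x) (pd m U x + s • pd m W x)
        (pd m U x + s • pd m W x)) (fderiv ℝ (fun y => h y (pd m U x) (pd m U x)) (U x) (W x)
          + h (U x) (pd m W x) (pd m U x) + h (U x) (pd m U x) (pd m W x)) 0 := by
      intro m
      have hd : DifferentiableAt ℝ (fun p : E × E × E => h p.1 p.2.1 p.2.2)
          (U x + (0 : ℝ) • W x, pd m U x + (0 : ℝ) • pd m W x,
            pd m U x + (0 : ℝ) • pd m W x) := by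
        simp only [zero_smul, add_zero]
        exact (hr.contDiffOn_metric.contDiffAt
          ((hr.isOpen.prod isOpen_univ).mem_nhds ⟨hUx, trivial⟩)).differentiableAt (by simp)
      have hc := hd.hasFDerivAt.comp_hasDerivAt (0 : ℝ) ((hlineder (U x) (W x)).prodMk
        ((hlineder (pd m U x) (pd m W x)).prodMk (hlineder (pd m U x) (pd m W x))))
      refine HasDerivAt.congr_deriv hc ?_
      simp only [zero_smul, add_zero]
      exact hr.metric.fderiv_uncurried hr.isOpen hr.contDiffOn_metric hUx _ _ _ _ _
    have hL : fderiv ℝ G (0, x) (1, 0) = ∑ m, etaCoeff m x *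
        (fderiv ℝ (fun y => h y (pd m U x) (pd m U x)) (U x) (W x)
          + h (U x) (pd m W x) (pd m U x) + h (U x) (pd m U x) (pd m W x)) := by
      have hc1 := hGd.hasFDerivAt.comp_hasDerivAt (0 : ℝ)
        ((hasDerivAt_id (0 : ℝ)).prodMk (hasDerivAt_const (0 : ℝ) x))
      exact hc1.unique (HasDerivAt.fun_sum fun m _ => (hterm m).const_mul (etaCoeff m x))
    rw [hL, tension, hr.metric.sum_left hUx, Finset.mul_sum, Finset.mul_sum,
      ← Finset.sum_sub_distrib]
    refine Finset.sum_congr rfl fun m _ => ?_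
    rw [hXdef]
    simp only []
    rw [pd_metric hr hU (hcV m) hW hxd hUx, hr.metric.sub_left hUx, hr.metric.smul_left _ hUx,
      hr.metric.smul_left _ hUx, hr.force_eq _ hUx, hr.metric.symm _ hUx (pd m W x)]
    have hsm : fderiv ℝ (fun y => h y (etaCoeff m x • pd m U x) (W x)) (U x) (pd m U x) =
        etaCoeff m x * fderiv ℝ (fun y => h y (pd m U x) (W x)) (U x) (pd m U x) := by
      -- Homogeneity of `h y` is known only for `y ∈ N`, so the two functions are compared near `U
      -- x`.
      have hev : (fun y => h y (etaCoeff m x • pd m U x) (W x)) =ᶠ[nhds (U x)]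
          fun y => etaCoeff m x * h y (pd m U x) (W x) :=
        Filter.eventually_of_mem (hr.isOpen.mem_nhds hUx) fun y hy => hr.metric.smul_left y hy _ _ _
      rw [hev.fderiv_eq, fderiv_const_mul (((hr.metric.smooth _ _).contDiffAt
        (hr.isOpen.mem_nhds hUx)).differentiableAt (by simp))]
      rfl
    rw [hsm]
    ring
  rw [haction]
  refine hmain.congr_deriv ?_
  rw [MeasureTheory.setIntegral_congr_fun (isCompact_slab t₀ t₁).measurableSet hpt]
  have hT := isSmoothOnM_tension hr hU hUN
  have hTW : IsSmoothOnM fun x => h (U x) (tension r U x) (W x) :=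
    (hU.prodMk (hT.prodMk hW)).comp hr.contDiffOn_metric fun _ hx => ⟨hUN hx, trivial⟩
  have hint1 : MeasureTheory.IntegrableOn (fun x => ∑ m, pd m (X m) x) (slab t₀ t₁) :=
    (continuousOn_finsetSum _ fun m _ =>
      ((hX m).pd m).smooth.continuousOn.mono hdom).integrableOn_compact (isCompact_slab t₀ t₁)
  have hint2 : MeasureTheory.IntegrableOn (fun x => h (U x) (tension r U x) (W x))
      (slab t₀ t₁) :=
    (hTW.smooth.continuousOn.mono hdom).integrableOn_compact (isCompact_slab t₀ t₁)
  change ∫ x in slab t₀ t₁, _ = _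
  rw [MeasureTheory.integral_sub (hint1.const_mul 2) (hint2.const_mul 2),
    MeasureTheory.integral_const_mul, MeasureTheory.integral_const_mul, hdiv]
  ring

/-! ### The fundamental lemma of the calculus of variations -/

lemma slab_subset_closure_interior {t₀ t₁ : ℝ} (h : t₀ < t₁) :
    slab t₀ t₁ ⊆ closure (interior (slab t₀ t₁)) := by
  have hne : (interior (slab t₀ t₁)).Nonempty := by
    rw [slab, ← Set.pi_univ_Icc, interior_pi_set Set.finite_univ, Set.univ_pi_nonempty_iff]
    intro i
    have := Real.pi_pos
    fin_cases i <;> simp [h, this]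
  have hc : Convex ℝ (slab t₀ t₁) := convex_Icc _ _
  rw [hc.closure_interior_eq_closure_of_nonempty_interior hne]
  exact subset_closure

/-- A zero integral gives vanishing almost everywhere; continuity extends it to the whole slab,
which lies in the closure of its interior. -/
lemma eq_zero_of_setIntegral_slab_eq_zero {t₀ t₁ : ℝ} (h : t₀ < t₁) {q : Coord → ℝ}
    (hq : ContinuousOn q (slab t₀ t₁)) (hq0 : ∀ x ∈ slab t₀ t₁, 0 ≤ q x)
    (hint : ∫ x in slab t₀ t₁, q x = 0) : ∀ x ∈ slab t₀ t₁, q x = 0 := by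
  have hK := isCompact_slab t₀ t₁
  rw [MeasureTheory.setIntegral_eq_zero_iff_of_nonneg_ae
    ((MeasureTheory.ae_restrict_mem hK.measurableSet).mono hq0)
    (hq.integrableOn_compact hK)] at hint
  exact MeasureTheory.Measure.eqOn_of_ae_eq hint hq continuousOn_const
    (slab_subset_closure_interior h)

/-- Testing against `χ(t)` times the tension makes the first variation `-2 ∫ χ h(tension, tension)`,
whose integrand has a sign. A cutoff in time alone suffices because the tension is already periodic
in the angles. -/
theorem isWaveMap_iff_tension_eq_zero (hr : GeodesicForce N h r) (hU : IsSmoothOnM U)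
    (hUN : Set.MapsTo U dom N) :
    IsWaveMap etaMetric N h U ↔ ∀ x ∈ dom, tension r U x = 0 := by
  have hT := isSmoothOnM_tension hr hU hUN
  constructor
  · intro hwm x hx
    have hx0 : 0 < x 0 := hx
    -- Outer radius `x 0 / 2` keeps the support inside `[x 0 / 2, 3 x 0 / 2]`, away from `t = 0`.
    let χ : ContDiffBump (x 0) := ⟨x 0 / 4, x 0 / 2, by linarith, by linarith⟩
    have hχ : IsSmoothOnM fun y => χ (y 0) := isSmoothOnM_of_time (g := χ) χ.contDiff.contDiffOn
    have hW := hχ.smul hT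
    have hsupp : ∀ y ∈ dom, y 0 ∉ Set.Icc (x 0 / 2) (3 * x 0 / 2) →
        χ (y 0) • tension r U y = 0 := by
      intro y _ hy
      rw [χ.zero_of_le_dist, zero_smul]
      by_contra! hlt
      change dist (y 0) (x 0) < x 0 / 2 at hlt
      rw [Real.dist_eq, abs_lt] at hlt
      exact hy ⟨by linarith [hlt.1], by linarith [hlt.2]⟩
    have h0 : 0 < x 0 / 2 := by linarith
    have h1 : x 0 / 2 < 3 * x 0 / 2 := by linarith
    have huniq := (hasDerivAt_waveMapAction hr hU hUN h0 h1 hW hsupp).unique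
      (hwm.critical _ _ h0 h1 _ hW hsupp)
    set q : Coord → ℝ := fun y => h (U y) (tension r U y) (χ (y 0) • tension r U y) with hqdef
    have hq : IsSmoothOnM q :=
      (hU.prodMk (hT.prodMk hW)).comp hr.contDiffOn_metric fun _ hy => ⟨hUN hy, trivial⟩
    have hdom := slab_subset_dom (t₁ := 3 * x 0 / 2) h0
    have hqzero := eq_zero_of_setIntegral_slab_eq_zero h1 (hq.smooth.continuousOn.mono hdom)
      (fun y hy => ?_) (by linarith)
    · obtain ⟨y, hy, hy0, hym, hqy⟩ := exists_mem_fundamental_domain hq hx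
      have hys : y ∈ slab (x 0 / 2) (3 * x 0 / 2) :=
        mem_slab.2 ⟨by rw [hy0]; constructor <;> linarith, hym⟩
      have hqx : q x = 0 := hqy ▸ hqzero y hys
      have hχ1 : χ (x 0) = 1 := χ.one_of_mem_closedBall (Metric.mem_closedBall_self χ.rIn_pos.le)
      simp only [hqdef, hχ1, one_smul] at hqx
      by_contra hne
      exact (hr.metric.pos _ (hUN hx) _ hne).ne' hqx
    · simp only [hqdef]
      rw [hr.metric.smul_right (hUN (hdom hy))]
      refine mul_nonneg χ.nonneg ?_
      by_cases hz : tension r U y = 0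
      · rw [hz, hr.metric.zero_left (hUN (hdom hy))]
      · exact (hr.metric.pos _ (hUN (hdom hy)) _ hz).le
  · intro hzero
    refine ⟨hU, hUN, fun t₀ t₁ h0 h1 W hW hsupp => ?_⟩
    refine (hasDerivAt_waveMapAction hr hU hUN h0 h1 hW hsupp).congr_deriv ?_
    rw [MeasureTheory.setIntegral_congr_fun (g := fun _ => (0 : ℝ))
      (isCompact_slab t₀ t₁).measurableSet fun x hx => ?_]
    · simp
    · have hxd := slab_subset_dom h0 hx
      simp only [hzero x hxd]
      exact hr.metric.zero_left (hUN hxd) _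

end WaveMap

/-! ### The d'Alembertian of the three-metric -/

section Gamma

variable {lam : Coord → ℝ} {x : Coord}

/-- The diagonal components of the inverse of `γ`. -/
def gammaCoeff (lam : Coord → ℝ) (x : Coord) (m : Fin 3) : ℝ :=
  ![-Real.exp (-2 * lam x), Real.exp (-2 * lam x), (x 0 ^ 2)⁻¹] m

lemma gammaMetric_inv (lam : Coord → ℝ) (hx : x ∈ dom) :
    (gammaMetric lam x)⁻¹ = Matrix.diagonal (gammaCoeff lam x) := by
  have hx0 : x 0 ≠ 0 := ne_of_gt hx
  refine Matrix.inv_eq_right_inv ?_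
  rw [gammaMetric, Matrix.diagonal_mul_diagonal, ← Matrix.diagonal_one]
  congr 1
  ext i
  fin_cases i <;> simp [gammaCoeff, hx0, ← Real.exp_add]

lemma volDensity_gammaMetric (lam : Coord → ℝ) (hx : x ∈ dom) :
    volDensity (gammaMetric lam) x = Real.exp (2 * lam x) * x 0 := by
  have h : -(gammaMetric lam x).det = (Real.exp (2 * lam x) * x 0) ^ 2 := by
    simp [gammaMetric, Matrix.det_diagonal, Fin.prod_univ_three]
    ring
  rw [volDensity, h, Real.sqrt_sq (mul_pos (Real.exp_pos _) hx).le]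

lemma ip_gammaMetric (lam : Coord → ℝ) (hx : x ∈ dom) (v w : Fin 3 → ℝ) :
    ip (gammaMetric lam) x v w = ∑ m, gammaCoeff lam x m * v m * w m := by
  simp only [ip, gammaMetric_inv lam hx, Matrix.diagonal_apply, ite_mul, zero_mul,
    Finset.sum_ite_eq, Finset.mem_univ, if_true]

lemma sum_sum_ip_gammaMetric {n : ℕ} (hx : x ∈ dom) (P : Matrix (Fin n) (Fin n) ℝ)
    (v w : Fin n → Fin 3 → ℝ) :
    ∑ I, ∑ J, P I J * ip (gammaMetric lam) x (v I) (w J) =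
      ∑ m, gammaCoeff lam x m * ((fun I => v I m) ⬝ᵥ P.mulVec fun J => w J m) := by
  simp only [ip_gammaMetric lam hx, ← sum_sum_eq_dotProduct_mulVec, Finset.mul_sum]
  rw [Finset.sum_comm (s := Finset.univ (α := Fin 3))]
  refine Finset.sum_congr rfl fun I _ => ?_
  rw [Finset.sum_comm]
  refine Finset.sum_congr rfl fun m _ => Finset.sum_congr rfl fun J _ => ?_
  ring

lemma sum_sum_mul_ip_gammaMetric {n : ℕ} (hx : x ∈ dom) (P : Matrix (Fin n) (Fin n) ℝ)
    (c : ℝ) (v w : Fin n → Fin 3 → ℝ) :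
    ∑ I, ∑ J, P I J * c * ip (gammaMetric lam) x (v I) (w J) =
      c * ∑ m, gammaCoeff lam x m * ((fun I => v I m) ⬝ᵥ P.mulVec fun J => w J m) := by
  rw [← sum_sum_ip_gammaMetric hx]
  simp only [Finset.mul_sum]
  exact Finset.sum_congr rfl fun I _ => Finset.sum_congr rfl fun J _ => by ring

/-- Conformal invariance in two dimensions: `e^{2λ}` from the volume cancels `e^{-2λ}` from the
inverse metric. There is no such cancellation in the `ψ` direction. -/
lemma etaCoeff_eq (lam : Coord → ℝ) (hx : x ∈ dom) {m : Fin 3} (hm : m ≠ 2) :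
    (Real.exp (2 * lam x) * x 0)⁻¹ * etaCoeff m x = gammaCoeff lam x m := by
  have hx0 : x 0 ≠ 0 := ne_of_gt hx
  have he : Real.exp (-2 * lam x) = (Real.exp (2 * lam x))⁻¹ := by
    rw [← Real.exp_neg]; ring_nf
  fin_cases m
  · simp only [etaCoeff, gammaCoeff, he]
    simp
    field_simp
  · simp only [etaCoeff, gammaCoeff, he]
    simp
    field_simp
  · exact absurd rfl hm

lemma pd_two_eq_zero {E : Type*} [NormedAddCommGroup E] [NormedSpace ℝ E] {u : Coord → E}
    (hu : PsiIndependent u) (hx : x ∈ dom) : pd 2 u x = 0 := by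
  by_cases hd : DifferentiableAt ℝ u x
  · rw [pd, ← hd.lineDeriv_eq_fderiv]
    have hconst : (fun s : ℝ => u (x + s • Pi.single (M := fun _ => ℝ) (2 : Fin 3) 1)) =
        fun _ => u x := by
      funext s
      have hs : s • Pi.single (M := fun _ => ℝ) (2 : Fin 3) (1 : ℝ) = Pi.single 2 s := by
        rw [← Pi.single_smul, smul_eq_mul, mul_one]
      rw [hs]
      exact hu _ (add_single_mem_dom hx (by decide) s) _ hx (by simp) (by simp)
    rw [lineDeriv, hconst, deriv_const]
  -- Without differentiability `fderiv` is zero by convention.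
  · rw [pd, fderiv_zero_of_not_differentiableAt hd]
    rfl

/-- In the `t` and `θ` directions the fluxes for `γ` and `η` agree by `etaCoeff_eq`; in the `ψ`
direction `∂_ψ U = 0`, and `r (U x) 0 = 0` removes the force term as well. -/
lemma box_gammaMetric {E : Type*} [NormedAddCommGroup E] [NormedSpace ℝ E] {r : E → E → E}
    {U : Coord → E} (hU : IsSmoothOnM U) (hψ : PsiIndependent U) (hr0 : r (U x) 0 = 0)
    (L : E →L[ℝ] ℝ) (hx : x ∈ dom) :
    box (gammaMetric lam) (fun y => L (U y)) x =
      (Real.exp (2 * lam x) * x 0)⁻¹ * L (tension r U x)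
        + ∑ m, gammaCoeff lam x m * L (r (U x) (pd m U x)) := by
  have hflux : ∀ m, ∀ y ∈ dom, volDensity (gammaMetric lam) y *
      ∑ n, (gammaMetric lam y)⁻¹ m n * pd n (fun z => L (U z)) y =
        L (etaCoeff m y • pd m U y) := by
    intro m y hy
    rw [gammaMetric_inv lam hy, volDensity_gammaMetric lam hy]
    simp only [Matrix.diagonal_apply, ite_mul, zero_mul, Finset.sum_ite_eq, Finset.mem_univ,
      if_true, pd_clm L (hU.differentiableAt hy), map_smul, smul_eq_mul]
    by_cases hm : m = 2
    · rw [hm, pd_two_eq_zero hψ hy, map_zero, mul_zero, mul_zero, mul_zero]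
    · have hne : Real.exp (2 * lam y) * y 0 ≠ 0 := (mul_pos (Real.exp_pos _) hy).ne'
      rw [← etaCoeff_eq lam hy hm, ← mul_assoc, mul_inv_cancel_left₀ hne]
  have hdiff : ∀ m, DifferentiableAt ℝ (fun y => etaCoeff m y • pd m U y) x := fun m =>
    ((isSmoothOnM_etaCoeff m).smul (hU.pd m)).differentiableAt hx
  rw [box, volDensity_gammaMetric lam hx, tension, map_sum, Finset.mul_sum, Finset.mul_sum,
    ← Finset.sum_add_distrib]
  refine Finset.sum_congr rfl fun m _ => ?_
  rw [pd_congr (hflux m) m hx, pd_clm L (hdiff m), map_sub, map_smul, smul_eq_mul]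
  by_cases hm : m = 2
  · rw [hm, pd_two_eq_zero hψ hx, hr0, map_zero]
    ring
  · rw [← etaCoeff_eq lam hx hm]
    ring

lemma box_gammaMetric_eq_iff {E : Type*} [NormedAddCommGroup E] [NormedSpace ℝ E]
    {r : E → E → E} {U : Coord → E} (hU : IsSmoothOnM U) (hψ : PsiIndependent U)
    (hr0 : r (U x) 0 = 0) (L : E →L[ℝ] ℝ) (hx : x ∈ dom) {c : ℝ}
    (hc : c = ∑ m, gammaCoeff lam x m * L (r (U x) (pd m U x))) :
    box (gammaMetric lam) (fun y => L (U y)) x = c ↔ L (tension r U x) = 0 := by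
  have hne : (Real.exp (2 * lam x) * x 0)⁻¹ ≠ 0 :=
    inv_ne_zero (mul_pos (Real.exp_pos _) hx).ne'
  rw [box_gammaMetric hU hψ hr0 L hx, hc, add_eq_right, mul_eq_zero, or_iff_right hne]

end Gamma

/-! ### The evolution equations -/

section Evolution

variable {n : ℕ}

/-- The coordinate `f_{IJ}`. -/
def coordMat (I J : Fin n) : Target n →L[ℝ] ℝ :=
  (ContinuousLinearMap.proj s(I, J)).comp (ContinuousLinearMap.fst ℝ _ _)

/-- The coordinate `Q_I`. -/
def coordQ (I : Fin n) : Target n →L[ℝ] ℝ :=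
  (ContinuousLinearMap.proj I).comp
    ((ContinuousLinearMap.fst ℝ _ _).comp (ContinuousLinearMap.snd ℝ _ _))

/-- The coordinate `Φ_I`. -/
def coordPhi (I : Fin n) : Target n →L[ℝ] ℝ :=
  (ContinuousLinearMap.proj I).comp ((ContinuousLinearMap.fst ℝ _ _).comp
    ((ContinuousLinearMap.snd ℝ _ _).comp (ContinuousLinearMap.snd ℝ _ _)))

/-- The coordinate `Ψ`. -/
def coordPsi : Target n →L[ℝ] ℝ :=
  (ContinuousLinearMap.fst ℝ _ _).comp ((ContinuousLinearMap.snd ℝ _ _).comp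
    ((ContinuousLinearMap.snd ℝ _ _).comp (ContinuousLinearMap.snd ℝ _ _)))

/-- The coordinate `φ`. -/
def coordDil : Target n →L[ℝ] ℝ :=
  (ContinuousLinearMap.snd ℝ _ _).comp ((ContinuousLinearMap.snd ℝ _ _).comp
    ((ContinuousLinearMap.snd ℝ _ _).comp (ContinuousLinearMap.snd ℝ _ _)))

lemma target_eq_zero_iff (v : Target n) :
    v = 0 ↔ coordDil v = 0 ∧ (∀ I, coordQ I v = 0) ∧ (∀ I J, coordMat I J v = 0) ∧
      (∀ I, coordPhi I v = 0) ∧ coordPsi v = 0 := by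
  constructor
  · rintro rfl
    simp
  · rintro ⟨h1, h2, h3, h4, h5⟩
    refine Prod.ext (funext fun s => ?_) (Prod.ext (funext h2) (Prod.ext (funext h4)
      (Prod.ext h5 h1)))
    induction s with | _ I J => exact h3 I J

lemma force_zero (a : ℝ) (u : Target n) : force a u 0 = 0 := by
  have h1 : fMat (0 : Target n) = 0 := rfl
  have h2 : tPhi (0 : Target n) = 0 := rfl
  have h3 : tPsi (0 : Target n) = 0 := rfl
  have h4 : twistVec u 0 = 0 := by
    ext I; simp [twistVec, tQ, tPhi, tPsi]
  have h5 : forceDil a u 0 = 0 := by simp [forceDil, h2, h3]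
  have h6 : forceMat a u 0 = 0 := by simp [forceMat, h1, h2, h4, h5, Matrix.vecMulVec_zero]
  have h7 : forcePhi a u 0 = 0 := by simp [forcePhi, h1, h2, h4]
  have h8 : forcePsi a u 0 = 0 := by simp [forcePsi, h1, h2, h3]
  rw [target_eq_zero_iff]
  refine ⟨?_, fun I => ?_, fun I J => ?_, fun I => congrFun h7 I, h8⟩
  · change -(a / 2) * forceDil a u 0 = 0
    rw [h5, mul_zero]
  · simp [coordQ, force, h4, h7, h8]
  · exact congrFun (congrFun h6 I) J

lemma geodesicForce_targetMetric (a : ℝ) :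
    GeodesicForce (targetSet n) (targetMetric a) (force a) where
  isOpen := isOpen_targetSet n
  metric := isRiemannianMetricOn_targetMetric a
  contDiffOn_metric := targetMetric_contDiffOn a
  contDiffOn_force := contDiffOn_force a
  force_eq _ hu v w := targetMetric_force hu v w

lemma mul_mul_apply_eq {Y : Matrix (Fin n) (Fin n) ℝ} (P : Matrix (Fin n) (Fin n) ℝ)
    (hY : Yᵀ = Y) (I J : Fin n) : (Y * P * Y) I J = Y I ⬝ᵥ P.mulVec (Y J) := by
  have hJ : Y J = fun K => Y K J := by
    funext K; exact congrFun (congrFun hY K) J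
  rw [Matrix.mul_assoc, Matrix.mul_apply, hJ]
  rfl

lemma mul_mulVec_apply_eq (Y P : Matrix (Fin n) (Fin n) ℝ) (p : Fin n → ℝ) (I : Fin n) :
    (Y * P).mulVec p I = Y I ⬝ᵥ P.mulVec p := by
  rw [← Matrix.mulVec_mulVec]
  rfl

variable {U : Coord → Target n} {x : Coord}

lemma grad_fDet (hU : IsSmoothOnM U) (hx : x ∈ dom) (hUx : U x ∈ targetSet n) :
    grad (fun y => (fMat (U y)).det) x =
      fun m => fDet (U x) * ((fMat (U x))⁻¹ * fMat (pd m U x)).trace := by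
  funext m
  have hc := ((contDiff_fDet.differentiable (by simp) (U x)).hasFDerivAt.comp x
    (hU.differentiableAt hx).hasFDerivAt).fderiv
  rw [← fderiv_fDet hUx, grad, pd, show (fun y => (fMat (U y)).det) = fDet ∘ U from rfl, hc]
  rfl

/-- By `box_gammaMetric_eq_iff` it is enough that each right-hand side is the `γ`-trace of the
matching component of `force`; the coordinates together detect the vanishing of the tension. -/
theorem evolutionEquations_iff_tension_eq_zero {D : ℕ} (hD : (D : ℝ) - 2 = n + 1) (a : ℝ)
    (hU : IsSmoothOnM U) (hψ : PsiIndependent U) (hUN : Set.MapsTo U dom (targetSet n))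
    (lam : Coord → ℝ) :
    EvolutionEquations D a (gammaMetric lam) (fun x => fMat (U x)) (fun I x => tQ (U x) I)
      (fun I x => tPhi (U x) I) (fun x => tPsi (U x)) (fun x => tDil (U x)) ↔
      ∀ x ∈ dom, tension (force a) U x = 0 := by
  have hgrad : ∀ L : Target n →L[ℝ] ℝ, ∀ x ∈ dom,
      grad (fun y => L (U y)) x = fun m => L (pd m U x) := fun L x hx =>
    funext fun m => pd_clm L (hU.differentiableAt hx) m
  have gF : ∀ x ∈ dom, ∀ I J, grad (fun y => fMat (U y) I J) x = fun m => fMat (pd m U x) I J :=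
    fun x hx I J => hgrad (coordMat I J) x hx
  have gQ : ∀ x ∈ dom, ∀ I, grad (fun y => tQ (U y) I) x = fun m => tQ (pd m U x) I :=
    fun x hx I => hgrad (coordQ I) x hx
  have gPhi : ∀ x ∈ dom, ∀ I, grad (fun y => tPhi (U y) I) x = fun m => tPhi (pd m U x) I :=
    fun x hx I => hgrad (coordPhi I) x hx
  have gPsi : ∀ x ∈ dom, grad (fun y => tPsi (U y)) x = fun m => tPsi (pd m U x) :=
    fun x hx => hgrad coordPsi x hx
  have gDil : ∀ x ∈ dom, grad (fun y => tDil (U y)) x = fun m => tDil (pd m U x) :=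
    fun x hx => hgrad coordDil x hx
  have gA : ∀ x ∈ dom, ∀ I, twistCov (fun I x => tQ (U x) I) (fun I x => tPhi (U x) I)
      (fun x => tPsi (U x)) I x = fun m => twistVec (U x) (pd m U x) I := by
    intro x hx I
    funext m
    simp only [twistCov, gQ x hx, gPhi x hx, gPsi x hx, twistVec, Pi.add_apply, Pi.sub_apply,
      Pi.smul_apply, smul_eq_mul]
    ring
  have key : ∀ L : Target n →L[ℝ] ℝ, ∀ x ∈ dom, ∀ c : ℝ,
      c = ∑ m, gammaCoeff lam x m * L (force a (U x) (pd m U x)) →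
      (box (gammaMetric lam) (fun y => L (U y)) x = c ↔ L (tension (force a) U x) = 0) :=
    fun L x hx c hc => box_gammaMetric_eq_iff hU hψ (force_zero a (U x)) L hx hc
  have hdet : ∀ x ∈ dom, (fMat (U x)).det⁻¹ * fDet (U x) = 1 := fun x hx =>
    inv_mul_cancel₀ (fDet_pos (hUN hx)).ne'
  have hdot : ∀ (y p z : Fin n → ℝ) (c : ℝ),
      (fun J => y J + c * p J) ⬝ᵥ z = y ⬝ᵥ z + c * (p ⬝ᵥ z) := fun y p z c => by
    rw [← smul_eq_mul, ← smul_dotProduct, ← add_dotProduct]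
    rfl
  have kDil := fun x hx => key coordDil x hx (-(a / 2) *
      (Real.exp (-2 * a * tDil (U x)) * ∑ I, ∑ J, (fMat (U x))⁻¹ I J *
        ip (gammaMetric lam) x (grad (fun y => tPhi (U y) I) x) (grad (fun y => tPhi (U y) J) x)
        - Real.exp (2 * a * tDil (U x)) * (fMat (U x)).det⁻¹ *
          ip (gammaMetric lam) x (grad (fun y => tPsi (U y)) x) (grad (fun y => tPsi (U y)) x)))
    (by
      simp only [gPhi x hx, gPsi x hx]
      simp only [sum_sum_ip_gammaMetric hx]
      simp only [ip_gammaMetric lam hx]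
      change _ = ∑ m, gammaCoeff lam x m * (-(a / 2) * forceDil a (U x) (pd m U x))
      simp only [forceDil, Fin.sum_univ_three, fDet]
      ring)
  have kPsi := fun x hx => key coordPsi x hx
    ((fMat (U x)).det⁻¹ * ip (gammaMetric lam) x (grad (fun y => (fMat (U y)).det) x)
        (grad (fun y => tPsi (U y)) x)
      + Real.exp (-2 * a * tDil (U x)) *
        ∑ I, ∑ J, (fMat (U x))⁻¹ I J * ip (gammaMetric lam) x (grad (fun y => tPhi (U y) I) x)
          (twistCov (fun I x => tQ (U x) I) (fun I x => tPhi (U x) I) (fun x => tPsi (U x)) J x)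
      - 2 * a * ip (gammaMetric lam) x (grad (fun y => tDil (U y)) x)
        (grad (fun y => tPsi (U y)) x))
    (by
      simp only [gPhi x hx, gPsi x hx, gA x hx, gDil x hx, grad_fDet hU hx (hUN hx)]
      simp only [sum_sum_ip_gammaMetric hx]
      simp only [ip_gammaMetric lam hx]
      change _ = ∑ m, gammaCoeff lam x m * forcePsi a (U x) (pd m U x)
      simp only [forcePsi, Fin.sum_univ_three]
      -- The gradient of `det f` brings a factor `det f`, to be cancelled against the explicit
      -- inverse determinant.
      linear_combination (norm := skip) (∑ m, gammaCoeff lam x m * ((fMat (U x))⁻¹ * fMat (pd m U x)).trace *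
        tPsi (pd m U x)) * hdet x hx
      simp only [Fin.sum_univ_three]
      ring)
  have kPhi := fun x hx I => key (coordPhi I) x hx
    (∑ J, ∑ K, (fMat (U x))⁻¹ J K * ip (gammaMetric lam) x (grad (fun y => fMat (U y) I J) x)
        (grad (fun y => tPhi (U y) K) x)
      - (fMat (U x)).det⁻¹ * Real.exp (2 * a * tDil (U x)) *
        ip (gammaMetric lam) x (grad (fun y => tPsi (U y)) x)
          (twistCov (fun I x => tQ (U x) I) (fun I x => tPhi (U x) I) (fun x => tPsi (U x)) I x)
      + 2 * a * ip (gammaMetric lam) x (grad (fun y => tDil (U y)) x)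
        (grad (fun y => tPhi (U y) I) x))
    (by
      simp only [gF x hx, gPhi x hx, gPsi x hx, gA x hx, gDil x hx]
      simp only [sum_sum_ip_gammaMetric hx]
      simp only [ip_gammaMetric lam hx]
      change _ = ∑ m, gammaCoeff lam x m * forcePhi a (U x) (pd m U x) I
      simp only [forcePhi, Pi.add_apply, Pi.sub_apply, Pi.smul_apply, smul_eq_mul,
        mul_mulVec_apply_eq, Fin.sum_univ_three, fDet]
      ring)
  have kF := fun x hx I J => key (coordMat I J) x hx
    (∑ K, ∑ L, (fMat (U x))⁻¹ K L * ip (gammaMetric lam) x (grad (fun y => fMat (U y) I K) x)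
        (grad (fun y => fMat (U y) J L) x)
      - (fMat (U x)).det⁻¹ * ip (gammaMetric lam) x
          (twistCov (fun I x => tQ (U x) I) (fun I x => tPhi (U x) I) (fun x => tPsi (U x)) I x)
          (twistCov (fun I x => tQ (U x) I) (fun I x => tPhi (U x) I) (fun x => tPsi (U x)) J x)
      - 2 * Real.exp (-2 * a * tDil (U x)) * ip (gammaMetric lam) x
          (grad (fun y => tPhi (U y) I) x) (grad (fun y => tPhi (U y) J) x)
      + 2 / ((D : ℝ) - 2) * fMat (U x) I J *
        (Real.exp (-2 * a * tDil (U x)) * ∑ K, ∑ L, (fMat (U x))⁻¹ K L *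
          ip (gammaMetric lam) x (grad (fun y => tPhi (U y) K) x) (grad (fun y => tPhi (U y) L) x)
          - Real.exp (2 * a * tDil (U x)) * (fMat (U x)).det⁻¹ *
            ip (gammaMetric lam) x (grad (fun y => tPsi (U y)) x) (grad (fun y => tPsi (U y)) x)))
    (by
      simp only [gF x hx, gPhi x hx, gPsi x hx, gA x hx, hD]
      simp only [sum_sum_ip_gammaMetric hx]
      simp only [ip_gammaMetric lam hx]
      change _ = ∑ m, gammaCoeff lam x m * forceMat a (U x) (pd m U x) I J
      simp only [forceMat, forceDil, Matrix.add_apply, Matrix.sub_apply, Matrix.smul_apply,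
        smul_eq_mul, mul_mul_apply_eq _ (fMat_isSymm _), Matrix.vecMulVec_apply,
        Fin.sum_univ_three, fDet]
      ring)
  -- The right-hand side is the twist part of the force minus `Ψ` times the `Φ_I` equation plus
  -- `Φ_I` times the `Ψ` equation, written out.
  have kQ := fun x hx I => key (coordQ I) x hx
    ((fMat (U x)).det⁻¹ * ip (gammaMetric lam) x
        (grad (fun y => (fMat (U y)).det) x
          + (Real.exp (2 * a * tDil (U x)) * tPsi (U x)) • grad (fun y => tPsi (U y)) x)
        (twistCov (fun I x => tQ (U x) I) (fun I x => tPhi (U x) I) (fun x => tPsi (U x)) I x)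
      + ∑ J, ∑ K, (fMat (U x))⁻¹ J K * ip (gammaMetric lam) x
        (grad (fun y => fMat (U y) I J) x
          + (Real.exp (-2 * a * tDil (U x)) * tPhi (U x) I) • grad (fun y => tPhi (U y) J) x)
        (twistCov (fun I x => tQ (U x) I) (fun I x => tPhi (U x) I) (fun x => tPsi (U x)) K x)
      + (fMat (U x)).det⁻¹ * tPhi (U x) I * ip (gammaMetric lam) x
        (grad (fun y => (fMat (U y)).det) x) (grad (fun y => tPsi (U y)) x)
      - ∑ J, ∑ K, (fMat (U x))⁻¹ J K * tPsi (U x) * ip (gammaMetric lam) x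
        (grad (fun y => fMat (U y) I J) x) (grad (fun y => tPhi (U y) K) x)
      - 2 * a * (tPsi (U x) * ip (gammaMetric lam) x (grad (fun y => tDil (U y)) x)
            (grad (fun y => tPhi (U y) I) x)
          + tPhi (U x) I * ip (gammaMetric lam) x (grad (fun y => tDil (U y)) x)
            (grad (fun y => tPsi (U y)) x)))
    (by
      simp only [gF x hx, gPhi x hx, gPsi x hx, gA x hx, gDil x hx, grad_fDet hU hx (hUN hx)]
      simp only [sum_sum_ip_gammaMetric hx, sum_sum_mul_ip_gammaMetric hx]
      simp only [ip_gammaMetric lam hx, Pi.add_apply, Pi.smul_apply, smul_eq_mul, hdot]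
      change _ = ∑ m, gammaCoeff lam x m * ((((fMat (U x))⁻¹ * fMat (pd m U x)).trace •
          twistVec (U x) (pd m U x) + (fMat (pd m U x) * (fMat (U x))⁻¹).mulVec
            (twistVec (U x) (pd m U x))
        - tPsi (U x) • forcePhi a (U x) (pd m U x)
        + forcePsi a (U x) (pd m U x) • tPhi (U x) : Fin n → ℝ) I)
      simp only [forcePhi, forcePsi, Pi.add_apply, Pi.sub_apply, Pi.smul_apply, smul_eq_mul,
        mul_mulVec_apply_eq, Fin.sum_univ_three]
      have hd := hdet x hx
      simp only [fDet] at hd ⊢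
      linear_combination (norm := skip) (∑ m, gammaCoeff lam x m * ((fMat (U x))⁻¹ * fMat (pd m U x)).trace *
        (twistVec (U x) (pd m U x) I + tPhi (U x) I * tPsi (pd m U x))) * hd
      simp only [Fin.sum_univ_three]
      ring)
  constructor
  · intro h x hx
    rw [target_eq_zero_iff]
    exact ⟨(kDil x hx).1 (h.dilaton x hx), fun I => (kQ x hx I).1 (h.twist x hx I),
      fun I J => (kF x hx I J).1 (h.scalarMultiplet x hx I J),
      fun I => (kPhi x hx I).1 (h.maxwellPhi x hx I), (kPsi x hx).1 (h.maxwellPsi x hx)⟩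
  · intro h
    have h' := fun x hx => (target_eq_zero_iff _).1 (h x hx)
    exact ⟨fun x hx => (kDil x hx).2 (h' x hx).1, fun x hx I => (kQ x hx I).2 ((h' x hx).2.1 I),
      fun x hx I J => (kF x hx I J).2 ((h' x hx).2.2.1 I J),
      fun x hx I => (kPhi x hx I).2 ((h' x hx).2.2.2.1 I),
      fun x hx => (kPsi x hx).2 (h' x hx).2.2.2.2⟩

end Evolution

end EMD

end

theorem lemma1 (D : ℕ) (hD : 4 ≤ D) (a : ℝ) :
    IsOpen (EMD.targetSet (D - 3)) ∧
    EMD.IsDiffeomorphicToEuclidean (EMD.targetSet (D - 3)) ((D - 2) * (D + 1) / 2) ∧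
    EMD.IsRiemannianMetricOn (EMD.targetMetric a) (EMD.targetSet (D - 3)) ∧
    ∀ U : EMD.Coord → EMD.Target (D - 3),
      EMD.IsSmoothOnM U → EMD.PsiIndependent U →
      Set.MapsTo U EMD.dom (EMD.targetSet (D - 3)) →
      ∀ lam : EMD.Coord → ℝ, EMD.IsSmoothOnM lam → EMD.PsiIndependent lam →
        (EMD.IsWaveMap EMD.etaMetric (EMD.targetSet (D - 3)) (EMD.targetMetric a) U ↔
          EMD.EvolutionEquations D a (EMD.gammaMetric lam)
            (fun x => EMD.fMat (U x))
            (fun I x => EMD.tQ (U x) I)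
            (fun I x => EMD.tPhi (U x) I)
            (fun x => EMD.tPsi (U x))
            (fun x => EMD.tDil (U x))) := by
  -- The truncated subtraction is genuine because `4 ≤ D`; this matches `2 / (D - 2)` with the
  -- coefficient `2 / (n + 1)` in `forceMat`.
  have hcast : (D : ℝ) - 2 = ((D - 3 : ℕ) : ℝ) + 1 := by
    rw [Nat.cast_sub (by omega)]
    push_cast
    ring
  have hdim : (D - 2) * (D + 1) / 2 = (D - 3 + 1) * (D - 3 + 4) / 2 := by
    congr 2 <;> omega
  refine ⟨EMD.isOpen_targetSet _, ?_, EMD.isRiemannianMetricOn_targetMetric a, ?_⟩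
  · rw [hdim]
    exact EMD.isDiffeomorphicToEuclidean_targetSet _
  · intro U hU hψ hUN lam _ _
    rw [EMD.isWaveMap_iff_tension_eq_zero (EMD.geodesicForce_targetMetric a) hU hUN,
      EMD.evolutionEquations_iff_tension_eq_zero hcast a hU hψ hUN lam]
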